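/- Let $(W,S)$ be a finite Weyl group with its set $S$ of simple reflections and length function $\ell$ (that is, $(W,S)$ is a finite Coxeter system in which the product of any two distinct simple reflections has order $2$, $3$, $4$ or $6$). Let $\mathbb{A}=\mathbb{Z}[v,v^{-1}]$ and let $\mathbf{H}$ be the Hecke algebra of $(W,S)$, i.e. the $\mathbb{A}$-algebra generated by $H_s$, $s\in S$, subject to the braid relations of $(W,S)$ and the relations $H_s^2=1+(v^{-1}-v)H_s$. For $w\in W$ with reduced expression $w=s_1\cdots s_k$ put $H_w=H_{s_1}\cdots H_{s_k}$. The bar involution is the ring automorphism of $\mathbf{H}$ with $\overline{v}=v^{-1}$ and $\overline{H_s}=H_s^{-1}$, and $\{\underline{H}_w : w\in W\}$ is the Kazhdan-Lusztig (KL) basis, in which $\underline{H}_w$ is the unique element with $\overline{\underline{H}_w}=\underline{H}_w$ and $\underline{H}_w\in H_w+\sum_{x\in W}v\mathbb{Z}[v]H_x$. For $x,y\in W$ write $x\leq_L y$ (equivalently $y\geq_L x$) if there is $w\in W$ such that $\underline{H}_y$ appears with a non-zero coefficient in the expression of $\underline{H}_w\underline{H}_x$ in the KL basis. For $w\in W$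 let $\mathbf{LM}_w$ be the $\mathbb{A}$-span of all $\underline{H}_u$ with $u\geq_L w$. Let $W'$ be a parabolic subgroup of $W$, i.e. a subgroup generated by a subset of $S$, and let $w'_0$ be the longest element of $W'$. Then $$\mathbf{H}\,\underline{H}_{w'_0}=\mathbf{LM}_{w'_0}.$$ In particular, $\underline{H}_u\in\mathbf{H}\,\underline{H}_{w'_0}$ for every $u\in W$ with $u\geq_L w'_0$. -/

import Mathlib

namespace KLHecke

/-- The ring of Laurent polynomials `ℤ[v, v⁻¹]`. -/
abbrev LaurentRing : Type := LaurentPolynomial ℤ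

/-- The indeterminate `v`. -/
noncomputable def v : LaurentRing := LaurentPolynomial.T 1

/-- The inverse `v⁻¹` of the indeterminate. -/
noncomputable def vInv : LaurentRing := LaurentPolynomial.T (-1)

section Algebra

variable {B : Type*} (M : CoxeterMatrix B)

/-- The product `… f i * f j * f i * f j` with `m` alternating factors (the last one is `f j`). -/
def altProd {R : Type*} [Monoid R] (f : B → R) (i j : B) (m : ℕ) : R :=
  ((CoxeterSystem.alternatingWord i j m).map f).prod

/-- The defining relations of the Hecke algebra, in the free algebra on the simple reflections:
the braid relations (none for a pair with `M i j = 0`, i.e. of infinite order) and the quadratic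
relations `H_s ^ 2 = 1 + (v⁻¹ - v) H_s`. -/
inductive Rel : FreeAlgebra LaurentRing B → FreeAlgebra LaurentRing B → Prop
  | braid (i j : B) :
      Rel (altProd (FreeAlgebra.ι LaurentRing) i j (M i j))
        (altProd (FreeAlgebra.ι LaurentRing) j i (M i j))
  | quadratic (i : B) :
      Rel (FreeAlgebra.ι LaurentRing i * FreeAlgebra.ι LaurentRing i)
        (1 + (vInv - v) • FreeAlgebra.ι LaurentRing i)

/-- The Hecke algebra of a Coxeter matrix: the `ℤ[v, v⁻¹]`-algebra generated by `H_s`, for the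
simple reflections `s`, subject to the braid relations and the quadratic relations. -/
def HeckeAlgebra : Type _ := RingQuot (Rel M)

noncomputable instance : Ring (HeckeAlgebra M) := inferInstanceAs (Ring (RingQuot (Rel M)))

noncomputable instance : Algebra LaurentRing (HeckeAlgebra M) :=
  inferInstanceAs (Algebra LaurentRing (RingQuot (Rel M)))

/-- The canonical map from the free algebra to the Hecke algebra. -/
noncomputable def ofFree : FreeAlgebra LaurentRing B →ₐ[LaurentRing] HeckeAlgebra M :=
  RingQuot.mkAlgHom LaurentRing (Rel M)

/-- The generator `H_s`. -/
noncomputable def gen (i : B) : HeckeAlgebra M := ofFree M (FreeAlgebra.ι LaurentRing i)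

variable {M}

theorem map_altProd {R R' F : Type*} [Monoid R] [Monoid R'] [FunLike F R R']
    [MonoidHomClass F R R'] (φ : F) (f : B → R) (i j : B) (m : ℕ) :
    φ (altProd f i j m) = altProd (fun k => φ (f k)) i j m := by
  simp [altProd, map_list_prod, List.map_map, Function.comp_def]

theorem gen_braid (i j : B) :
    altProd (gen M) i j (M i j) = altProd (gen M) j i (M i j) := by
  have h := RingQuot.mkAlgHom_rel LaurentRing (Rel.braid (M := M) i j)
  exact (map_altProd (ofFree M) _ i j _).symm.trans (Eq.trans h (map_altProd (ofFree M) _ j i _))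

theorem gen_mul_self (i : B) : gen M i * gen M i = 1 + (vInv - v) • gen M i := by
  have h : ofFree M _ = ofFree M _ :=
    RingQuot.mkAlgHom_rel LaurentRing (Rel.quadratic (M := M) i)
  rw [map_mul, map_add, map_one, map_smul] at h
  exact h

/-- `H_s` is invertible, with inverse `H_s + (v - v⁻¹)`. -/
noncomputable def genUnit (i : B) : (HeckeAlgebra M)ˣ where
  val := gen M i
  inv := gen M i + (v - vInv) • 1
  val_inv := by
    rw [mul_add, gen_mul_self, mul_smul_comm, mul_one]
    module
  inv_val := by
    rw [add_mul, gen_mul_self, smul_mul_assoc, one_mul]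
    module

theorem alternatingWord_reverse (i j : B) (m : ℕ) :
    (CoxeterSystem.alternatingWord i j m).reverse =
      if Even m then CoxeterSystem.alternatingWord j i m
      else CoxeterSystem.alternatingWord i j m := by
  induction m generalizing i j with
  | zero => simp [CoxeterSystem.alternatingWord]
  | succ m ih =>
    conv_lhs => rw [CoxeterSystem.alternatingWord_succ', List.reverse_cons, ih]
    by_cases h : Even m
    · have h' : ¬ Even (m + 1) := by simpa [Nat.even_add_one] using h
      simp only [h, h', if_true, if_false]
      rw [CoxeterSystem.alternatingWord_succ]
      simp
    · have h' : Even (m + 1) := by simpa [Nat.even_add_one] using h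
      simp only [h, h', if_true, if_false]
      rw [CoxeterSystem.alternatingWord_succ]
      simp

theorem altProd_inv {G : Type*} [Group G] (f : B → G) (i j : B) (m : ℕ) :
    (altProd f i j m)⁻¹ =
      if Even m then altProd (fun k => (f k)⁻¹) j i m
      else altProd (fun k => (f k)⁻¹) i j m := by
  have h : (altProd f i j m)⁻¹ =
      ((CoxeterSystem.alternatingWord i j m).reverse.map fun k => (f k)⁻¹).prod := by
    rw [altProd, List.prod_inv_reverse, ← List.map_reverse, ← List.map_reverse, List.map_map]
    rfl
  rw [h, alternatingWord_reverse]
  split_ifs <;> rfl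

theorem genUnit_inv_braid (i j : B) :
    altProd (fun k => ((genUnit (M := M) k)⁻¹ : (HeckeAlgebra M)ˣ)) i j (M i j) =
      altProd (fun k => ((genUnit (M := M) k)⁻¹ : (HeckeAlgebra M)ˣ)) j i (M i j) := by
  have h : altProd (genUnit (M := M)) i j (M i j) = altProd (genUnit (M := M)) j i (M i j) := by
    apply Units.ext
    have h1 := map_altProd (Units.coeHom (HeckeAlgebra M)) (genUnit (M := M)) i j (M i j)
    have h2 := map_altProd (Units.coeHom (HeckeAlgebra M)) (genUnit (M := M)) j i (M i j)
    exact h1.trans ((gen_braid i j).trans h2.symm)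
  have h' := congrArg (fun g => g⁻¹) h
  simp only [altProd_inv] at h'
  split_ifs at h' with hm
  · exact h'.symm
  · exact h'

variable (M)

/-- A copy of the ring `HeckeAlgebra M` on which `v` acts as multiplication by `v⁻¹`. -/
def BarTwist : Type _ := HeckeAlgebra M

noncomputable instance : Ring (BarTwist M) := inferInstanceAs (Ring (HeckeAlgebra M))

noncomputable instance : Algebra LaurentRing (BarTwist M) :=
  RingHom.toAlgebra'
    (((algebraMap LaurentRing (HeckeAlgebra M)).comp
      (LaurentPolynomial.invert (R := ℤ) : LaurentRing →+* LaurentRing) :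
        LaurentRing →+* HeckeAlgebra M))
    (fun c x => Algebra.commutes (A := HeckeAlgebra M) (LaurentPolynomial.invert (R := ℤ) c) x)

variable {M}

theorem barTwist_smul (c : LaurentRing) (x : HeckeAlgebra M) :
    (c • (show BarTwist M from x) : BarTwist M) =
      (LaurentPolynomial.invert (R := ℤ) c • x : HeckeAlgebra M) :=
  (Algebra.smul_def (A := HeckeAlgebra M) (LaurentPolynomial.invert (R := ℤ) c) x).symm

/-- The image `H_s⁻¹` of `H_s` under the bar involution. -/
noncomputable def barGen (i : B) : BarTwist M :=
  show HeckeAlgebra M from ((genUnit (M := M) i)⁻¹ : (HeckeAlgebra M)ˣ)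

theorem barGen_rel ⦃x y : FreeAlgebra LaurentRing B⦄ (h : Rel M x y) :
    FreeAlgebra.lift LaurentRing (barGen (M := M)) x =
      FreeAlgebra.lift LaurentRing (barGen (M := M)) y := by
  induction h with
  | braid i j =>
    rw [map_altProd, map_altProd]
    simp only [FreeAlgebra.lift_ι_apply]
    have h := congrArg (Units.coeHom (HeckeAlgebra M)) (genUnit_inv_braid (M := M) i j)
    rw [map_altProd, map_altProd] at h
    exact h
  | quadratic i =>
    simp only [map_mul, map_add, map_one, map_smul, FreeAlgebra.lift_ι_apply]
    have h2 : ((vInv - v) • barGen (M := M) i : BarTwist M) =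
        ((v - vInv) • (gen M i + (v - vInv) • (1 : HeckeAlgebra M)) : HeckeAlgebra M) := by
      refine (barTwist_smul (vInv - v) _).trans ?_
      have : LaurentPolynomial.invert (R := ℤ) (vInv - v) = v - vInv := by
        simp [v, vInv, LaurentPolynomial.invert_T]
      rw [this]
      rfl
    rw [h2]
    change ((gen M i + (v - vInv) • (1 : HeckeAlgebra M)) *
        (gen M i + (v - vInv) • (1 : HeckeAlgebra M)) : HeckeAlgebra M) =
      1 + (v - vInv) • (gen M i + (v - vInv) • (1 : HeckeAlgebra M))
    simp only [mul_add, add_mul, gen_mul_self, smul_mul_assoc, mul_smul_comm, one_mul, mul_one]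
    module

variable (M)

/-- The bar involution: the ring endomorphism of the Hecke algebra with `v ↦ v⁻¹` and
`H_s ↦ H_s⁻¹`. -/
noncomputable def bar : HeckeAlgebra M →+* HeckeAlgebra M :=
  (RingQuot.liftAlgHom LaurentRing (s := Rel M) (B := BarTwist M)
    ⟨FreeAlgebra.lift LaurentRing (barGen (M := M)), barGen_rel⟩ : RingQuot (Rel M) →+* BarTwist M)

theorem bar_gen (i : B) : bar M (gen M i) = ((genUnit (M := M) i)⁻¹ : (HeckeAlgebra M)ˣ) :=
  (RingQuot.liftAlgHom_mkAlgHom_apply LaurentRing (FreeAlgebra.lift LaurentRing (barGen (M := M)))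
    barGen_rel _).trans (FreeAlgebra.lift_ι_apply _ _)

theorem bar_smul (c : LaurentRing) (x : HeckeAlgebra M) :
    bar M (c • x) = LaurentPolynomial.invert (R := ℤ) c • bar M x := by
  refine (map_smul (RingQuot.liftAlgHom LaurentRing (s := Rel M) (B := BarTwist M)
    ⟨FreeAlgebra.lift LaurentRing (barGen (M := M)), barGen_rel⟩) c x).trans ?_
  exact barTwist_smul c _

end Algebra

section Basis

variable {B W : Type*} [Group W] {M : CoxeterMatrix B} (cs : CoxeterSystem M W)

/-- A Weyl group with its simple reflections: a finite Coxeter system which is crystallographic,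
i.e. the product of two distinct simple reflections has order `2`, `3`, `4` or `6`. -/
def IsFiniteWeyl (_cs : CoxeterSystem M W) : Prop :=
  Finite W ∧ ∀ i j : B, i ≠ j → M i j = 2 ∨ M i j = 3 ∨ M i j = 4 ∨ M i j = 6

/-- The standard basis element `H_w = H_{s₁} ⋯ H_{sₖ}`, for a reduced expression
`w = s₁ ⋯ sₖ` (by the braid relations, it does not depend on the expression). -/
noncomputable def stdElt (w : W) : HeckeAlgebra M :=
  ((cs.exists_isReduced w).choose.map (gen M)).prod

/-- The characterization of the Kazhdan-Lusztig element of `w`: it is bar-invariant, and is equal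
to `H_w` plus a sum of elements of `v ℤ[v] H_u`, `u ∈ W`. -/
def IsKLElt (w : W) (h : HeckeAlgebra M) : Prop :=
  bar M h = h ∧
    ∃ p : W →₀ Polynomial ℤ,
      h = stdElt cs w +
        p.sum fun u q => Polynomial.toLaurent (Polynomial.X * q) • stdElt cs u

/-- The Kazhdan-Lusztig basis element of `w`: the unique element satisfying `IsKLElt cs w`. -/
noncomputable def klElt (w : W) : HeckeAlgebra M :=
  Classical.epsilon (IsKLElt cs w)

/-- The Kazhdan-Lusztig element of `y` appears with a non-zero coefficient in the expression of
`h` with respect to the Kazhdan-Lusztig basis. -/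
def AppearsIn (y : W) (h : HeckeAlgebra M) : Prop :=
  ∃ c : W →₀ LaurentRing, h = (c.sum fun u a => a • klElt cs u) ∧ c y ≠ 0

/-- The left Kazhdan-Lusztig pre-order `x ≤_L y`. -/
def LeftLE (x y : W) : Prop := ∃ w : W, AppearsIn cs y (klElt cs w * klElt cs x)

/-- The `ℤ[v, v⁻¹]`-span of all Kazhdan-Lusztig basis elements of `u`, for `u ≥_L w`. -/
noncomputable def leftModule (w : W) : Submodule LaurentRing (HeckeAlgebra M) :=
  Submodule.span LaurentRing (klElt cs '' {u | LeftLE cs w u})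

/-- The cyclic left submodule `H · h` of the left regular module. -/
noncomputable def cyclicLeft (h : HeckeAlgebra M) : Submodule (HeckeAlgebra M) (HeckeAlgebra M) :=
  Submodule.span (HeckeAlgebra M) {h}

/-- The (standard) parabolic subgroup generated by a set of simple reflections. -/
def parabolic (J : Set B) : Subgroup W := Subgroup.closure (cs.simple '' J)

/-- `w` is a longest element of the subgroup `P`. -/
def IsLongestIn (P : Subgroup W) (w : W) : Prop :=
  w ∈ P ∧ ∀ u ∈ P, cs.length u ≤ cs.length w

end Basis

end KLHecke

/-! Let `J` be the set of simple reflections generating the parabolic subgroup, let `w₀` be its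
longest element, and call `x` maximal if all elements of `J` are right descents of `x`. Both sides
are equal to the module `rightEigen J` of all `h` with `h H_s = v⁻¹ h` for `s ∈ J`.

For `h` in this module, comparing coefficients of standard basis elements shows that the leading
terms of `h` (of maximal length) are multiples of `H_x` with `x` maximal. If `x` is maximal, then
`x = z w₀` with `ℓ(x) = ℓ(z) + ℓ(w₀)`, so `H_z` times the Kazhdan-Lusztig element of `w₀` has leading
term `H_x`; the Kazhdan-Lusztig element of `x` has leading term `H_x` as well, and both lie in the
module. Subtracting leading terms repeatedly, the module is the left ideal generated by the
element of `w₀` (`cyclicLeft_eq_rightEigen`), and it is also the span of the Kazhdan-Lusztig elements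
of the maximal `x` (`rightEigen_eq_span_klElt`). As the Kazhdan-Lusztig elements form a basis, every
one that appears in an element of the ideal belongs to it. No positivity of structure constants is
involved.

The prerequisites on Coxeter groups rest on the cocycle `inversionParity`, which gives the strong
exchange condition, and on the geometric representation, which shows that the product of two simple
reflections has the order prescribed by the Coxeter matrix. They yield Matsumoto's theorem
(`CoxeterSystem.prod_map_eq_of_isReduced`), by which the elements `H_w` span the Hecke algebra. Their
independence follows from the left regular representation on the free module with basis `W`: the
braid relations hold there as both sides commute with all right multiplications and agree at `1`.
The Kazhdan-Lusztig basis is constructed by induction on the length, together with the property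
that the element of `x` is an eigenvector for right multiplication by `H_s` at each right descent
`s` of `x`. -/

/-! ### The geometric representation and the order of a product of two simple reflections -/

namespace CoxeterMatrix

variable {B : Type*} (M : CoxeterMatrix B)

/-- The linear form `x ↦ ⟨α_i, x⟩` of the geometric representation, normalised so that
`⟨α_i, α_j⟩ = -2 cos (π / m_ij)` (this is `-2` if `m_ij = 0`, that is, `m_ij = ∞`). -/
noncomputable def rootForm (i : B) : Module.Dual ℝ (B →₀ ℝ) :=
  Finsupp.linearCombination ℝ fun k => -2 * Real.cos (Real.pi / M i k)

theorem rootForm_single (i k : B) :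
    M.rootForm i (Finsupp.single k 1) = -2 * Real.cos (Real.pi / M i k) := by
  simp [rootForm]

theorem rootForm_self (i : B) : M.rootForm i (Finsupp.single i 1) = 2 := by
  simp [rootForm_single]

theorem rootForm_mul_rootForm_sub_two (i j : B) :
    M.rootForm i (Finsupp.single j 1) * M.rootForm j (Finsupp.single i 1) - 2 =
      2 * Real.cos (2 * (Real.pi / M i j)) := by
  rw [rootForm_single, rootForm_single, M.symmetric j i, Real.cos_two_mul]
  ring

/-- The reflection `x ↦ x - ⟨α_i, x⟩ α_i` of the geometric representation. -/
noncomputable def rootReflection (i : B) : (B →₀ ℝ) ≃ₗ[ℝ] (B →₀ ℝ) :=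
  Module.reflection (M.rootForm_self i)

open Polynomial.Chebyshev in
theorem isLiftable_rootReflection : M.IsLiftable M.rootReflection := by
  intro i j
  rcases eq_or_ne i j with rfl | hij
  · ext1 x
    simpa [rootReflection] using Module.involutive_reflection (M.rootForm_self i) x
  rcases Nat.eq_zero_or_pos (M i j) with h0 | hpos
  · rw [h0, pow_zero]
  rcases eq_or_ne (M i j) 2 with h2 | h2
  · have hi : M.rootForm i (Finsupp.single j 1) = 0 := by simp [rootForm_single, h2]
    have hj : M.rootForm j (Finsupp.single i 1) = 0 := by
      simp [rootForm_single, M.symmetric j i, h2]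
    ext1 x
    simp only [h2, pow_two, rootReflection, LinearEquiv.mul_apply, Module.reflection_apply,
      map_sub, map_smul, hi, hj, rootForm_self, LinearEquiv.coe_one, id_eq]
    module
  have h1 : M i j ≠ 1 := by
    rintro h
    exact M.off_diagonal i j hij h
  have h3 : 3 ≤ M i j := by omega
  have hm : (3 : ℝ) ≤ (M i j : ℝ) := by exact_mod_cast h3
  set m : ℝ := (M i j : ℝ) with hmdef
  set θ : ℝ := 2 * (Real.pi / m) with hθ
  have hθpos : 0 < θ := by have := Real.pi_pos; positivity
  have hθm : m * θ = 2 * Real.pi := by rw [hθ]; field_simp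
  have hsin : Real.sin θ ≠ 0 := by
    refine (Real.sin_pos_of_pos_of_lt_pi hθpos ?_).ne'
    nlinarith [Real.pi_pos]
  ext1 x
  rw [rootReflection, rootReflection, Module.reflection_mul_reflection_pow_apply
    (M.rootForm_self i) (M.rootForm_self j) (M i j) x _
    (M.rootForm_mul_rootForm_sub_two i j).symm]
  have key (n : ℤ) : (S ℝ n).eval (2 * Real.cos θ) * Real.sin θ = Real.sin ((n + 1) * θ) :=
    S_two_mul_real_cos θ n
  -- For even `m`, both coefficients contain `S_{m/2-1}`, and for odd `m` they contain
  -- `S_{(m-1)/2} + S_{(m-3)/2}`; each of these vanishes at `2 cos (2π / m)`.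
  rcases Nat.even_or_odd' (M i j) with ⟨p, hp | hp⟩
  · have e1 : ((M i j : ℤ) - 2) / 2 = p - 1 := by omega
    have e2 : ((M i j : ℤ) - 1) / 2 = p - 1 := by omega
    have hz : (S ℝ (p - 1 : ℤ)).eval (2 * Real.cos θ) = 0 := by
      have := key (p - 1)
      have e : (((p : ℤ) - 1 : ℤ) + 1 : ℝ) * θ = Real.pi := by
        have : m = 2 * p := by rw [hmdef, hp]; push_cast; ring
        rw [this] at hθm
        push_cast
        linarith
      rw [e, Real.sin_pi] at this
      exact (mul_eq_zero.mp this).resolve_right hsin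
    rw [e1, e2, hz]
    simp
  · have e1 : ((M i j : ℤ) - 1) / 2 = p := by omega
    have e2 : ((M i j : ℤ) - 3) / 2 = p - 1 := by omega
    have e3 : (M i j : ℤ) / 2 = p := by omega
    have e4 : ((M i j : ℤ) - 2) / 2 = p - 1 := by omega
    have hz : (S ℝ (p : ℤ)).eval (2 * Real.cos θ) + (S ℝ (p - 1 : ℤ)).eval (2 * Real.cos θ)
        = 0 := by
      have h := key p
      have h' := key (p - 1)
      have e : (((p : ℤ) : ℝ) + 1) * θ = 2 * Real.pi - p * θ := by
        have : m = 2 * p + 1 := by rw [hmdef, hp]; push_cast; ring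
        rw [this] at hθm
        push_cast
        linarith
      have e' : (((p : ℤ) - 1 : ℤ) + 1 : ℝ) * θ = p * θ := by push_cast; ring
      rw [e, Real.sin_two_pi_sub] at h
      rw [e'] at h'
      refine (mul_eq_zero.mp (?_ : _ * Real.sin θ = 0)).resolve_right hsin
      rw [add_mul, h, h']
      ring
    rw [e1, e2, e3, e4, hz]
    simp

open Polynomial.Chebyshev in
theorem rootReflection_mul_pow_ne_one {i j : B} (hij : i ≠ j) {k : ℕ} (hk : 0 < k)
    (hkM : k < M i j) : (M.rootReflection i * M.rootReflection j) ^ k ≠ 1 := by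
  intro h
  have hx := congrArg (fun r : (B →₀ ℝ) ≃ₗ[ℝ] (B →₀ ℝ) => r (Finsupp.single i 1)) h
  simp only [rootReflection] at hx
  rw [Module.reflection_mul_reflection_pow_apply_self
    (M.rootForm_self i) (M.rootForm_self j) k _
    (M.rootForm_mul_rootForm_sub_two i j).symm] at hx
  have hxi := DFunLike.congr_fun hx i
  have hxj := DFunLike.congr_fun hx j
  simp only [LinearEquiv.coe_one, id_eq, Finsupp.add_apply, Finsupp.smul_apply, smul_eq_mul,
    Finsupp.single_eq_same, Finsupp.single_eq_of_ne hij, Finsupp.single_eq_of_ne hij.symm,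
    mul_one, mul_zero, add_zero, zero_add, rootForm_single] at hxi hxj
  have h1 : M i j ≠ 1 := fun h => M.off_diagonal i j hij h
  rcases eq_or_ne (M i j) 2 with h2 | h2
  · have hk1 : k = 1 := by omega
    subst hk1
    have : 2 * (Real.pi / (2 : ℕ)) = Real.pi := by push_cast; ring
    rw [h2, this] at hxi
    norm_num at hxi
  have h3 : 3 ≤ M i j := by omega
  have hm : (3 : ℝ) ≤ (M i j : ℝ) := by exact_mod_cast h3
  rw [M.symmetric j i] at hxj
  have hkm : (k : ℝ) < M i j := by exact_mod_cast hkM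
  have hk0 : (0 : ℝ) < k := by exact_mod_cast hk
  set m : ℝ := (M i j : ℝ) with hmdef
  set θ : ℝ := 2 * (Real.pi / m) with hθ
  have hθpos : 0 < θ := by have := Real.pi_pos; positivity
  have hθm : m * θ = 2 * Real.pi := by rw [hθ]; field_simp
  have hsin : Real.sin θ ≠ 0 := by
    refine (Real.sin_pos_of_pos_of_lt_pi hθpos ?_).ne'
    nlinarith [Real.pi_pos]
  have hcos : Real.cos (Real.pi / m) ≠ 0 := by
    refine (Real.cos_pos_of_mem_Ioo ⟨?_, ?_⟩).ne'
    · have : 0 < Real.pi / m := by have := Real.pi_pos; positivity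
      linarith [Real.pi_pos]
    · have : 2 * (Real.pi / m) * m = 2 * Real.pi := by field_simp
      nlinarith [Real.pi_pos]
  have key (n : ℤ) : (S ℝ n).eval (2 * Real.cos θ) * Real.sin θ = Real.sin ((n + 1) * θ) :=
    S_two_mul_real_cos θ n
  have hS : (S ℝ (k - 1 : ℤ)).eval (2 * Real.cos θ) = 0 := by
    rcases mul_eq_zero.mp hxj with h | h
    · exact h
    · simp [hcos] at h
  rw [hS, add_zero] at hxi
  have hkk := key (k - 1)
  have e : (((k : ℤ) - 1 : ℤ) + 1 : ℝ) * θ = k * θ := by push_cast; ring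
  rw [hS, zero_mul, e] at hkk
  -- `sin (kθ) = 0` with `0 < kθ < 2π` forces `kθ = π`, and then `S_k (2 cos θ) = -1`.
  have hkθ : k * θ = Real.pi := by
    have hpos : 0 < k * θ := by positivity
    have hlt : k * θ < 2 * Real.pi := by rw [← hθm]; gcongr
    have := (Real.sin_eq_zero_iff_of_lt_of_lt (x := k * θ - Real.pi) (by linarith)
      (by linarith)).mp (by rw [Real.sin_sub_pi, ← hkk, neg_zero])
    linarith
  have hk2 := key k
  have e2 : (((k : ℤ) : ℝ) + 1) * θ = θ + Real.pi := by rw [← hkθ]; push_cast; ring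
  rw [e2, hxi, Real.sin_add_pi] at hk2
  apply hsin
  linarith

end CoxeterMatrix

namespace CoxeterSystem

variable {B W : Type*} [Group W] {M : CoxeterMatrix B} (cs : CoxeterSystem M W)

/-- The order of `s_i s_j` is not smaller than `m_ij`: the geometric representation detects it. -/
theorem simple_mul_simple_pow_ne_one {i j : B} (hij : i ≠ j) {k : ℕ} (hk : 0 < k)
    (hkM : k < M i j) : (cs.simple i * cs.simple j) ^ k ≠ 1 := by
  intro h
  have := congrArg (cs.lift ⟨_, M.isLiftable_rootReflection⟩) h
  rw [map_pow, map_mul, map_one, lift_apply_simple, lift_apply_simple] at this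
  exact M.rootReflection_mul_pow_ne_one hij hk hkM this

end CoxeterSystem

/-! ### The inversion cocycle and the exchange condition -/

namespace CoxeterSystem

variable {B W : Type*} [Group W] {M : CoxeterMatrix B} (cs : CoxeterSystem M W)

open Classical in
/-- The involution `(t, ε) ↦ (s_i t s_i, ε + [t = s_i])` of `W × ℤ/2`. -/
noncomputable def signedConj (i : B) : Equiv.Perm (W × ZMod 2) :=
  Function.Involutive.toPerm
    (fun p => (cs.simple i * p.1 * cs.simple i, p.2 + if p.1 = cs.simple i then 1 else 0)) <| by
    rintro ⟨t, ε⟩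
    have h : cs.simple i * t * cs.simple i = cs.simple i ↔ t = cs.simple i := by
      rw [mul_eq_right, ← cs.inv_simple i, inv_mul_eq_one, eq_comm, cs.inv_simple]
    have h2 (a : ZMod 2) : a + a = 0 := CharTwo.add_self_eq_zero a
    ext
    · simp [mul_assoc]
    · simp only [h, add_assoc, h2, add_zero]

open Classical in
theorem signedConj_apply (i : B) (t : W) (ε : ZMod 2) :
    cs.signedConj i (t, ε) =
      (cs.simple i * t * cs.simple i, ε + if t = cs.simple i then 1 else 0) := rfl

theorem pow_mul_simple (i j : B) (k : ℕ) :
    ((cs.simple i * cs.simple j) ^ k)⁻¹ * cs.simple j =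
      cs.simple j * (cs.simple i * cs.simple j) ^ k := by
  have h : (cs.simple i * cs.simple j)⁻¹ =
      cs.simple j * (cs.simple i * cs.simple j) * (cs.simple j)⁻¹ := by
    simp [mul_assoc]
  rw [← inv_pow, h, conj_pow, inv_mul_cancel_right]

open Classical in
theorem signedConj_mul_pow_apply (i j : B) (k : ℕ) (t : W) (ε : ZMod 2) :
    ((cs.signedConj i * cs.signedConj j) ^ k) (t, ε) =
      ((cs.simple i * cs.simple j) ^ k * t * ((cs.simple i * cs.simple j) ^ k)⁻¹,
        ε + ∑ l ∈ Finset.range (2 * k),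
          if t = cs.simple j * (cs.simple i * cs.simple j) ^ l then 1 else 0) := by
  induction k with
  | zero => simp
  | succ k ih =>
    set x := cs.simple i * cs.simple j with hx
    have h1 : x ^ k * t * (x ^ k)⁻¹ = cs.simple j ↔ t = cs.simple j * x ^ (2 * k) := by
      rw [mul_inv_eq_iff_eq_mul, ← eq_inv_mul_iff_mul_eq, ← mul_assoc, pow_mul_simple, ← hx,
        mul_assoc, ← pow_add, two_mul]
    have h2 : cs.simple j * (x ^ k * t * (x ^ k)⁻¹) * cs.simple j = cs.simple i ↔
        t = cs.simple j * x ^ (2 * k + 1) := by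
      have e : cs.simple j * (x ^ k * t * (x ^ k)⁻¹) * cs.simple j = cs.simple i ↔
          x ^ k * t * (x ^ k)⁻¹ = cs.simple j * x := by
        rw [← eq_mul_inv_iff_mul_eq, ← eq_inv_mul_iff_mul_eq, cs.inv_simple]
      rw [e, mul_inv_eq_iff_eq_mul, ← eq_inv_mul_iff_mul_eq, ← mul_assoc, ← mul_assoc,
        pow_mul_simple, ← hx, mul_assoc, mul_assoc, ← pow_succ', ← pow_add]
      congr! 3
      ring
    rw [pow_succ', Equiv.Perm.mul_apply, ih, Equiv.Perm.mul_apply, signedConj_apply,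
      signedConj_apply, mul_add, Finset.sum_range_succ, Finset.sum_range_succ]
    simp only [h1, h2]
    ext
    · simp [pow_succ', hx, mul_assoc]
    · simp only [add_assoc]

theorem isLiftable_signedConj : M.IsLiftable cs.signedConj := by
  classical
  intro i j
  ext1 ⟨t, ε⟩
  have hM := cs.simple_mul_simple_pow i j
  -- The `2m` elements `s_j (s_i s_j) ^ l` run twice through the same list of `m` reflections.
  rw [signedConj_mul_pow_apply, two_mul, Finset.sum_range_add]
  simp only [pow_add, hM, one_mul, mul_one, inv_one, CharTwo.add_self_eq_zero, add_zero,
    Equiv.Perm.coe_one, id_eq]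

/-- The parity of the number of occurrences of `t` in the right inversion sequence of any word
for `w`. For a reflection `t` it is `1` exactly if `t` is a right inversion of `w`. -/
noncomputable def inversionParity (w t : W) : ZMod 2 :=
  (cs.lift ⟨cs.signedConj, cs.isLiftable_signedConj⟩ w (t, 0)).2

theorem lift_signedConj_apply (w t : W) (ε : ZMod 2) :
    cs.lift ⟨cs.signedConj, cs.isLiftable_signedConj⟩ w (t, ε) =
      (w * t * w⁻¹, ε + cs.inversionParity w t) := by
  classical
  suffices h : ∃ a : ZMod 2, ∀ ε,
      cs.lift ⟨cs.signedConj, cs.isLiftable_signedConj⟩ w (t, ε) = (w * t * w⁻¹, ε + a) by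
    obtain ⟨a, ha⟩ := h
    rw [inversionParity, ha, ha, zero_add]
  induction w using cs.simple_induction_left with
  | one => exact ⟨0, by simp⟩
  | mul_simple_left w i ih =>
    obtain ⟨a, ha⟩ := ih
    refine ⟨a + if w * t * w⁻¹ = cs.simple i then 1 else 0, fun ε => ?_⟩
    rw [map_mul, Equiv.Perm.mul_apply, ha, lift_apply_simple, signedConj_apply]
    simp [mul_assoc, add_assoc]

theorem inversionParity_mul (x y t : W) :
    cs.inversionParity (x * y) t =
      cs.inversionParity y t + cs.inversionParity x (y * t * y⁻¹) := by
  rw [inversionParity, map_mul, Equiv.Perm.mul_apply, lift_signedConj_apply,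
    lift_signedConj_apply, zero_add]

@[simp] theorem inversionParity_one (t : W) : cs.inversionParity 1 t = 0 := by
  simp [inversionParity]

open Classical in
theorem inversionParity_simple (i : B) (t : W) :
    cs.inversionParity (cs.simple i) t = if t = cs.simple i then 1 else 0 := by
  rw [inversionParity, lift_apply_simple, signedConj_apply, zero_add]

open Classical in
theorem inversionParity_wordProd (ω : List B) (t : W) :
    cs.inversionParity (cs.wordProd ω) t = ((cs.rightInvSeq ω).count t : ℕ) := by
  induction ω with
  | nil => simp
  | cons i ω ih =>
    rw [wordProd_cons, inversionParity_mul, ih, inversionParity_simple, rightInvSeq,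
      List.count_cons, Nat.cast_add]
    congr 1
    have : cs.wordProd ω * t * (cs.wordProd ω)⁻¹ = cs.simple i ↔
        (cs.wordProd ω)⁻¹ * cs.simple i * cs.wordProd ω = t := by
      rw [mul_inv_eq_iff_eq_mul, ← eq_inv_mul_iff_mul_eq, mul_assoc, eq_comm]
    simp [this]

theorem IsReflection.inversionParity_self {t : W} (ht : cs.IsReflection t) :
    cs.inversionParity t t = 1 := by
  obtain ⟨x, i, rfl⟩ := ht
  have h := cs.inversionParity_mul x x⁻¹ (x * cs.simple i * x⁻¹)
  simp only [mul_inv_cancel, inversionParity_one, inv_inv, mul_assoc, inv_mul_cancel_left,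
    inv_mul_cancel, mul_one] at h
  have h' : cs.inversionParity (x * (cs.simple i * x⁻¹)) (x * (cs.simple i * x⁻¹)) =
      cs.inversionParity x⁻¹ (x * (cs.simple i * x⁻¹)) + 1 + cs.inversionParity x (cs.simple i) := by
    rw [inversionParity_mul, inversionParity_mul, inversionParity_simple]
    simp [mul_assoc]
  rw [mul_assoc, h', add_right_comm, ← h, zero_add]

theorem mem_rightInvSeq_of_inversionParity {ω : List B} {t : W}
    (h : cs.inversionParity (cs.wordProd ω) t = 1) : t ∈ cs.rightInvSeq ω := by
  classical
  by_contra hmem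
  rw [inversionParity_wordProd, List.count_eq_zero_of_not_mem hmem] at h
  simp at h

/-- The strong exchange condition, in the form that the right inversions of `w` are the
reflections at which the inversion cocycle of `w` is non-trivial. -/
theorem IsReflection.inversionParity_eq_one_iff {t : W} (ht : cs.IsReflection t) (w : W) :
    cs.inversionParity w t = 1 ↔ cs.length (w * t) < cs.length w := by
  have key (w : W) (h : cs.inversionParity w t = 1) : cs.length (w * t) < cs.length w := by
    obtain ⟨ω, hω, rfl⟩ := cs.exists_isReduced w
    exact (cs.isRightInversion_of_mem_rightInvSeq hω
      (cs.mem_rightInvSeq_of_inversionParity h)).2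
  refine ⟨key w, fun h => ?_⟩
  by_contra hne
  have h0 : cs.inversionParity w t = 0 := by
    generalize cs.inversionParity w t = a at hne
    revert a; decide
  have := key (w * t) (by
    rw [inversionParity_mul, ht.inversionParity_self, mul_inv_cancel_right, h0, add_zero])
  rw [mul_assoc, ht.mul_self, mul_one] at this
  exact lt_asymm h this

theorem isRightDescent_iff_inversionParity (w : W) (i : B) :
    cs.IsRightDescent w i ↔ cs.inversionParity w (cs.simple i) = 1 :=
  ((cs.isReflection_simple i).inversionParity_eq_one_iff cs w).symm

theorem exists_eraseIdx_of_isRightDescent {ω : List B} {i : B}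
    (h : cs.IsRightDescent (cs.wordProd ω) i) :
    ∃ k < ω.length, cs.wordProd ω * cs.simple i = cs.wordProd (ω.eraseIdx k) := by
  have hmem := cs.mem_rightInvSeq_of_inversionParity
    ((cs.isRightDescent_iff_inversionParity _ i).mp h)
  obtain ⟨k, hk, e⟩ := List.getElem_of_mem hmem
  refine ⟨k, by simpa using hk, ?_⟩
  rw [← cs.wordProd_mul_getD_rightInvSeq, List.getD_eq_getElem _ _ hk, e]

/-- The exchange condition. -/
theorem exists_eraseIdx_of_isLeftDescent {ω : List B} {i : B}
    (h : cs.IsLeftDescent (cs.wordProd ω) i) :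
    ∃ k < ω.length, cs.simple i * cs.wordProd ω = cs.wordProd (ω.eraseIdx k) := by
  rw [← cs.isRightDescent_inv_iff, ← cs.wordProd_reverse] at h
  obtain ⟨k, hk, e⟩ := cs.exists_eraseIdx_of_isRightDescent h
  rw [List.length_reverse] at hk
  refine ⟨ω.length - 1 - k, by omega, ?_⟩
  have e' := congrArg (·⁻¹) e
  simp only [wordProd_reverse, mul_inv_rev, inv_inv, inv_simple] at e'
  rw [e', ← wordProd_reverse]
  congr 1
  rw [List.eraseIdx_eq_take_drop_succ, List.eraseIdx_eq_take_drop_succ, List.reverse_append,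
    List.drop_reverse, List.take_reverse, List.reverse_reverse, List.reverse_reverse]
  congr 2 <;> omega

/-- Multiplication by `s_i` on the left changes the status of `j` as a right descent of `w` only
if `s_i w = w s_j`. -/
theorem isRightDescent_simple_mul_iff {w : W} {i j : B}
    (h : cs.simple i * w ≠ w * cs.simple j) :
    cs.IsRightDescent (cs.simple i * w) j ↔ cs.IsRightDescent w j := by
  classical
  rw [isRightDescent_iff_inversionParity, isRightDescent_iff_inversionParity,
    inversionParity_mul, inversionParity_simple, if_neg, add_zero]
  rw [mul_inv_eq_iff_eq_mul]
  exact h.symm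

theorem isLeftDescent_mul_simple_iff {w : W} {i j : B}
    (h : cs.simple i * w ≠ w * cs.simple j) :
    cs.IsLeftDescent (w * cs.simple j) i ↔ cs.IsLeftDescent w i := by
  rw [← isRightDescent_inv_iff, ← isRightDescent_inv_iff, mul_inv_rev, inv_simple,
    isRightDescent_simple_mul_iff]
  intro h'
  apply h
  have := congrArg (·⁻¹) h'
  simpa using this.symm

theorem nodup_rightInvSeq_iff (ω : List B) :
    (cs.rightInvSeq ω).Nodup ↔ cs.IsReduced ω := by
  classical
  refine ⟨fun h => ?_, IsReduced.nodup_rightInvSeq cs⟩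
  obtain ⟨τ, hτ, e⟩ := cs.exists_isReduced (cs.wordProd ω)
  refine le_antisymm (cs.length_wordProd_le ω) ?_
  have hsub : cs.rightInvSeq ω ⊆ cs.rightInvSeq τ := by
    intro t ht
    apply cs.mem_rightInvSeq_of_inversionParity
    rw [← e, inversionParity_wordProd, List.count_eq_one_of_mem h ht, Nat.cast_one]
  have := (List.subperm_of_subset h hsub).length_le
  rw [length_rightInvSeq, length_rightInvSeq] at this
  rwa [e, hτ.eq]

theorem isReduced_take_alternatingWord (i j : B) {m : ℕ} (hij : i ≠ j) (hm : m ≤ M i j) :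
    cs.IsReduced ((alternatingWord i j (2 * m)).take m) := by
  rw [← isReduced_reverse_iff, ← nodup_rightInvSeq_iff, ← List.nodup_reverse,
    rightInvSeq_reverse, List.reverse_reverse, leftInvSeq_take, List.nodup_iff_injective_get]
  have key (k : ℕ) (hk : k < m) : (cs.leftInvSeq (alternatingWord i j (2 * m)))[k]'(by
      simp; omega) = cs.simple i * (cs.simple j * cs.simple i) ^ k := by
    rw [getElem_leftInvSeq_alternatingWord cs i j m k (by omega),
      prod_alternatingWord_eq_mul_pow, if_neg (by simp)]
    congr 2
    omega
  have aux (k l : ℕ) (hkl : k < l) (hl : l < m) :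
      (cs.simple j * cs.simple i) ^ k ≠ (cs.simple j * cs.simple i) ^ l := by
    intro h
    apply cs.simple_mul_simple_pow_ne_one hij.symm (k := l - k) (by omega)
      (by rw [M.symmetric]; omega)
    rw [pow_sub _ hkl.le, h, mul_inv_cancel]
  rintro ⟨k, hk⟩ ⟨l, hl⟩ h
  simp only [List.length_take, length_leftInvSeq, length_alternatingWord, lt_min_iff] at hk hl
  simp only [List.get_eq_getElem, List.getElem_take] at h
  rw [key k hk.1, key l hl.1, mul_left_cancel_iff] at h
  rw [Fin.mk.injEq]
  by_contra hne
  rcases lt_or_gt_of_ne hne with hlt | hlt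
  · exact aux k l hlt hl.1 h
  · exact aux l k hlt hk.1 h.symm

/-- An alternating word in `s_i`, `s_j` of length at most `m_ij` is reduced, as the reflections in
its inversion sequence are distinct. -/
theorem isReduced_alternatingWord (i j : B) {m : ℕ} (hij : i ≠ j) (hm : m ≤ M i j) :
    cs.IsReduced (alternatingWord i j m) := by
  rcases Nat.eq_zero_or_pos m with rfl | hpos
  · simp [alternatingWord, IsReduced]
  have h1 := cs.isReduced_take_alternatingWord i j hij hm
  have h2 := cs.isReduced_take_alternatingWord j i hij.symm (M.symmetric i j ▸ hm)
  rw [listTake_alternatingWord _ _ _ _ (by omega)] at h1 h2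
  split_ifs at h1 h2 with h
  · exact h1
  · exact h2

end CoxeterSystem

/-! ### Matsumoto's theorem -/

namespace CoxeterSystem

variable {B W : Type*} [Group W] {M : CoxeterMatrix B} (cs : CoxeterSystem M W)

/-- An element with left descents `i` and `j` has reduced words starting with an alternating word
in `i`, `j` of any length up to `m_ij`. Each step applies the exchange condition: the letter to be
erased cannot lie in the alternating part, since longer alternating words are still reduced. -/
theorem exists_alternatingWord_append {i j : B} (hij : i ≠ j) {w : W}
    (hi : cs.IsLeftDescent w i) (hj : cs.IsLeftDescent w j) {k : ℕ} (hk : k ≤ M i j) :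
    ∃ c : List B, w = cs.wordProd (alternatingWord i j k ++ c) ∧ k + c.length = cs.length w := by
  induction k with
  | zero =>
    obtain ⟨c, hc, e⟩ := cs.exists_isReduced w
    exact ⟨c, by simpa [alternatingWord] using e, by rw [e, hc.eq, zero_add]⟩
  | succ k ih =>
    obtain ⟨c, hw, hc⟩ := ih (by omega)
    have hred := cs.isReduced_alternatingWord i j hij hk
    rw [alternatingWord_succ'] at hred ⊢
    set d := if Even k then j else i with hd
    have hdw : cs.IsLeftDescent w d := by
      rw [hd]; split_ifs <;> assumption
    have hdw' := hdw
    rw [hw] at hdw'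
    obtain ⟨p, hp, e⟩ := cs.exists_eraseIdx_of_isLeftDescent hdw'
    rw [← hw] at e
    rcases lt_or_ge p k with hpk | hpk
    · exfalso
      rw [List.eraseIdx_append_of_lt_length (by simpa using hpk), hw, wordProd_append,
        wordProd_append, ← mul_assoc, mul_left_inj, ← wordProd_cons] at e
      have h1 := hred.eq
      rw [e, List.length_cons] at h1
      have h2 := cs.length_wordProd_le ((alternatingWord i j k).eraseIdx p)
      have h3 := List.length_eraseIdx_le (alternatingWord i j k) p
      omega
    · rw [List.eraseIdx_append_of_length_le (by simpa using hpk)] at e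
      refine ⟨c.eraseIdx (p - (alternatingWord i j k).length), ?_, ?_⟩
      · rw [List.cons_append, wordProd_cons, ← e, simple_mul_simple_cancel_left]
      · have : p - (alternatingWord i j k).length < c.length := by simp at hp ⊢; omega
        rw [List.length_eraseIdx_of_lt this]
        omega

theorem IsReduced.tail {cs : CoxeterSystem M W} {i : B} {ω : List B} (h : cs.IsReduced (i :: ω)) :
    cs.IsReduced ω := by
  simpa using h.drop 1

theorem IsReduced.isLeftDescent {cs : CoxeterSystem M W} {i : B} {ω : List B}
    (h : cs.IsReduced (i :: ω)) : cs.IsLeftDescent (cs.wordProd (i :: ω)) i := by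
  rw [isLeftDescent_iff, h.eq, wordProd_cons, simple_mul_simple_cancel_left, h.tail.eq,
    List.length_cons]

/-- **Matsumoto's theorem**: a family in a monoid satisfying the braid relations has the same
product along any two reduced words of an element. -/
theorem prod_map_eq_of_isReduced {G : Type*} [Monoid G] (hM : ∀ i j, i ≠ j → M i j ≠ 0)
    (f : B → G)
    (hf : ∀ i j, KLHecke.altProd f i j (M i j) = KLHecke.altProd f j i (M i j))
    {ω ω' : List B} (hω : cs.IsReduced ω) (hω' : cs.IsReduced ω')
    (h : cs.wordProd ω = cs.wordProd ω') : (ω.map f).prod = (ω'.map f).prod := by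
  induction hn : ω.length generalizing ω ω' with
  | zero =>
    have h' := hω'.eq
    rw [← h, hω.eq, hn] at h'
    rw [List.eq_nil_of_length_eq_zero hn, List.eq_nil_of_length_eq_zero h'.symm]
  | succ n ih =>
    have hn' : ω'.length = n + 1 := by rw [← hω'.eq, ← h, hω.eq, hn]
    obtain ⟨i, a, rfl⟩ := List.exists_cons_of_length_eq_add_one hn
    obtain ⟨j, b, rfl⟩ := List.exists_cons_of_length_eq_add_one hn'
    -- Two reduced words of the same element with the same first letter.
    have step {d : B} {x y : List B} (hx : cs.IsReduced (d :: x)) (hy : cs.IsReduced (d :: y))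
        (hxn : x.length = n) (hxy : cs.wordProd (d :: x) = cs.wordProd (d :: y)) :
        ((d :: x).map f).prod = ((d :: y).map f).prod := by
      rw [List.map_cons, List.map_cons, List.prod_cons, List.prod_cons, ih hx.tail hy.tail _ hxn]
      rwa [wordProd_cons, wordProd_cons, mul_right_inj] at hxy
    rcases eq_or_ne i j with rfl | hij
    · exact step hω hω' (by simpa using hn) h
    have hi := hω.isLeftDescent
    have hj := hω'.isLeftDescent
    rw [← h] at hj
    obtain ⟨c, hc, hlen⟩ := cs.exists_alternatingWord_append hij hi hj le_rfl
    have hc' : cs.wordProd (i :: a) = cs.wordProd (alternatingWord j i (M i j) ++ c) := by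
      rw [hc, wordProd_append, wordProd_append]
      congr 1
      have := cs.wordProd_braidWord_eq i j
      rwa [braidWord, braidWord, M.symmetric j i] at this
    have hr : cs.IsReduced (alternatingWord i j (M i j) ++ c) := by
      rw [IsReduced, ← hc, ← hlen]; simp
    have hr' : cs.IsReduced (alternatingWord j i (M i j) ++ c) := by
      rw [IsReduced, ← hc', ← hlen]; simp
    have hprod : ((alternatingWord i j (M i j) ++ c).map f).prod =
        ((alternatingWord j i (M i j) ++ c).map f).prod := by
      rw [List.map_append, List.map_append, List.prod_append, List.prod_append]
      exact congrArg (· * _) (hf i j)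
    obtain ⟨m, hm⟩ := Nat.exists_eq_succ_of_ne_zero (hM i j hij)
    rw [hm] at hc hc' hr hr' hprod
    rw [alternatingWord_succ', alternatingWord_succ', List.cons_append, List.cons_append]
      at hprod
    rw [alternatingWord_succ', List.cons_append] at hc hc' hr hr'
    simp only [List.length_cons, Nat.add_right_cancel_iff] at hn hn'
    split_ifs at * with hev
    · rw [step hω hr' hn hc', step hω' hr hn' (h.symm.trans hc), hprod]
    · rw [step hω hr hn hc, step hω' hr' hn' (h.symm.trans hc'), hprod]

end CoxeterSystem

/-! ### The standard basis of the Hecke algebra -/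

namespace KLHecke

variable {B W : Type*} [Group W] {M : CoxeterMatrix B} (cs : CoxeterSystem M W)

open Classical in
/-- The coefficient of `H_w` in `H_s H_w`: it is `v⁻¹ - v` if `s` is a left descent of `w`, and
`0` otherwise. -/
noncomputable def leftCoeff (i : B) (w : W) : LaurentRing :=
  if cs.IsLeftDescent w i then vInv - v else 0

open Classical in
/-- The coefficient of `H_w` in `H_w H_s`: it is `v⁻¹ - v` if `s` is a right descent of `w`, and
`0` otherwise. -/
noncomputable def rightCoeff (i : B) (w : W) : LaurentRing :=
  if cs.IsRightDescent w i then vInv - v else 0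

/-- Left multiplication by `H_s` on the free module with basis `W`, the model of the left regular
representation of the Hecke algebra. -/
noncomputable def leftOp (i : B) : Module.End LaurentRing (W →₀ LaurentRing) :=
  Finsupp.linearCombination LaurentRing fun w =>
    Finsupp.single (cs.simple i * w) 1 + leftCoeff cs i w • Finsupp.single w 1

/-- Right multiplication by `H_s` on the free module with basis `W`. -/
noncomputable def rightOp (i : B) : Module.End LaurentRing (W →₀ LaurentRing) :=
  Finsupp.linearCombination LaurentRing fun w =>
    Finsupp.single (w * cs.simple i) 1 + rightCoeff cs i w • Finsupp.single w 1

theorem leftOp_single (i : B) (w : W) :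
    leftOp cs i (Finsupp.single w 1) =
      Finsupp.single (cs.simple i * w) 1 + leftCoeff cs i w • Finsupp.single w 1 := by
  simp [leftOp]

theorem rightOp_single (i : B) (w : W) :
    rightOp cs i (Finsupp.single w 1) =
      Finsupp.single (w * cs.simple i) 1 + rightCoeff cs i w • Finsupp.single w 1 := by
  simp [rightOp]

theorem leftCoeff_eq_zero {i : B} {w : W} (h : ¬ cs.IsLeftDescent w i) : leftCoeff cs i w = 0 :=
  if_neg h

theorem rightCoeff_eq_zero {i : B} {w : W} (h : ¬ cs.IsRightDescent w i) :
    rightCoeff cs i w = 0 := if_neg h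

theorem leftCoeff_of_isLeftDescent {i : B} {w : W} (h : cs.IsLeftDescent w i) :
    leftCoeff cs i w = vInv - v := if_pos h

theorem rightCoeff_of_isRightDescent {i : B} {w : W} (h : cs.IsRightDescent w i) :
    rightCoeff cs i w = vInv - v := if_pos h

theorem leftCoeff_simple_mul (i : B) (w : W) :
    leftCoeff cs i (cs.simple i * w) + leftCoeff cs i w = vInv - v := by
  have := cs.isLeftDescent_iff_not_isLeftDescent_mul (w := w) (i := i)
  by_cases h : cs.IsLeftDescent w i
  · rw [leftCoeff_of_isLeftDescent cs h, leftCoeff_eq_zero cs (this.mp h), zero_add]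
  · rw [leftCoeff_eq_zero cs h, leftCoeff_of_isLeftDescent cs (by tauto), add_zero]

theorem commute_leftOp_rightOp (i j : B) : Commute (leftOp cs i) (rightOp cs j) := by
  classical
  refine Finsupp.lhom_ext' fun w => LinearMap.ext_ring ?_
  change leftOp cs i (rightOp cs j (Finsupp.single w 1)) =
    rightOp cs j (leftOp cs i (Finsupp.single w 1))
  simp only [leftOp_single, rightOp_single, map_add, map_smul, mul_assoc]
  by_cases h : cs.simple i * w = w * cs.simple j
  · have e : leftCoeff cs i w = rightCoeff cs j w :=
      if_congr (by rw [CoxeterSystem.IsLeftDescent, CoxeterSystem.IsRightDescent, h]) rfl rfl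
    have e' : leftCoeff cs i (w * cs.simple j) = rightCoeff cs j (cs.simple i * w) :=
      if_congr (by rw [CoxeterSystem.IsLeftDescent, CoxeterSystem.IsRightDescent, ← mul_assoc, h])
        rfl rfl
    rw [e, e', h]
  · have e : rightCoeff cs j (cs.simple i * w) = rightCoeff cs j w :=
      if_congr (cs.isRightDescent_simple_mul_iff h) rfl rfl
    have e' : leftCoeff cs i (w * cs.simple j) = leftCoeff cs i w :=
      if_congr (cs.isLeftDescent_mul_simple_iff h) rfl rfl
    rw [e, e']
    module

theorem leftOp_mul_self (i : B) :
    leftOp cs i * leftOp cs i = 1 + (vInv - v) • leftOp cs i := by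
  refine Finsupp.lhom_ext' fun w => LinearMap.ext_ring ?_
  change leftOp cs i (leftOp cs i (Finsupp.single w 1)) =
    Finsupp.single w 1 + (vInv - v) • leftOp cs i (Finsupp.single w 1)
  rw [← leftCoeff_simple_mul cs i w]
  simp only [leftOp_single, map_add, map_smul, cs.simple_mul_simple_cancel_left]
  by_cases h : cs.IsLeftDescent w i
  · rw [leftCoeff_eq_zero cs (cs.isLeftDescent_iff_not_isLeftDescent_mul.mp h)]
    module
  · rw [leftCoeff_eq_zero cs h]
    module

theorem prod_leftOp_single_one {ω : List B} (hω : cs.IsReduced ω) :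
    (ω.map (leftOp cs)).prod (Finsupp.single 1 1) = Finsupp.single (cs.wordProd ω) 1 := by
  induction ω with
  | nil => simp
  | cons i ω ih =>
    have hd : ¬ cs.IsLeftDescent (cs.wordProd ω) i := by
      have := hω.isLeftDescent
      rwa [cs.isLeftDescent_iff_not_isLeftDescent_mul, CoxeterSystem.wordProd_cons,
        cs.simple_mul_simple_cancel_left] at this
    rw [List.map_cons, List.prod_cons, Module.End.mul_apply, ih hω.tail, leftOp_single,
      leftCoeff_eq_zero cs hd, zero_smul, add_zero, CoxeterSystem.wordProd_cons]

/-- An endomorphism commuting with all right multiplications is determined by its value at `1`. -/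
theorem end_ext_of_commute_rightOp {φ ψ : Module.End LaurentRing (W →₀ LaurentRing)}
    (hφ : ∀ j, Commute φ (rightOp cs j)) (hψ : ∀ j, Commute ψ (rightOp cs j))
    (h : φ (Finsupp.single 1 1) = ψ (Finsupp.single 1 1)) : φ = ψ := by
  refine Finsupp.lhom_ext' fun w => LinearMap.ext_ring ?_
  change φ (Finsupp.single w 1) = ψ (Finsupp.single w 1)
  induction hn : cs.length w generalizing w with
  | zero => rwa [cs.length_eq_zero_iff.mp hn]
  | succ n ih =>
    have hw : w ≠ 1 := by rintro rfl; simp at hn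
    obtain ⟨j, hj⟩ := cs.exists_rightDescent_of_ne_one hw
    have hd := cs.isRightDescent_iff_not_isRightDescent_mul.mp hj
    have e : Finsupp.single w 1 = rightOp cs j (Finsupp.single (w * cs.simple j) 1) := by
      rw [rightOp_single, rightCoeff_eq_zero cs hd, cs.simple_mul_simple_cancel_right]
      simp
    have hl := cs.isRightDescent_iff.mp hj
    have hφj := congrArg (fun χ => χ (Finsupp.single (w * cs.simple j) 1)) (hφ j).eq
    have hψj := congrArg (fun χ => χ (Finsupp.single (w * cs.simple j) 1)) (hψ j).eq
    simp only [Module.End.mul_apply] at hφj hψj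
    rw [e, hφj, hψj, ih _ (by omega)]

theorem leftOp_braid (i j : B) :
    altProd (leftOp cs) i j (M i j) = altProd (leftOp cs) j i (M i j) := by
  rcases eq_or_ne i j with rfl | hij
  · rfl
  have hc (a b k : B) : Commute (altProd (leftOp cs) a b (M i j)) (rightOp cs k) := by
    refine Commute.list_prod_left _ _ fun x hx => ?_
    obtain ⟨l, -, rfl⟩ := List.mem_map.mp hx
    exact commute_leftOp_rightOp cs l k
  refine end_ext_of_commute_rightOp cs (hc i j) (hc j i) ?_
  have h1 := cs.isReduced_alternatingWord i j hij le_rfl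
  have h2 := cs.isReduced_alternatingWord j i hij.symm (M.symmetric i j).le
  have hb := cs.wordProd_braidWord_eq i j
  rw [CoxeterSystem.braidWord, CoxeterSystem.braidWord, M.symmetric j i] at hb
  rw [altProd, altProd, prod_leftOp_single_one cs h1, prod_leftOp_single_one cs h2, hb]

/-- The left regular representation of the Hecke algebra, on the free module with basis `W`. -/
noncomputable def regularRep :
    HeckeAlgebra M →ₐ[LaurentRing] Module.End LaurentRing (W →₀ LaurentRing) :=
  RingQuot.liftAlgHom LaurentRing (s := Rel M)
    ⟨FreeAlgebra.lift LaurentRing (leftOp cs), fun x y h => by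
      induction h with
      | braid i j =>
        rw [map_altProd, map_altProd]
        simp only [FreeAlgebra.lift_ι_apply]
        exact leftOp_braid cs i j
      | quadratic i =>
        simp only [map_mul, map_add, map_one, map_smul, FreeAlgebra.lift_ι_apply]
        exact leftOp_mul_self cs i⟩

theorem regularRep_gen (i : B) : regularRep cs (gen M i) = leftOp cs i :=
  (RingQuot.liftAlgHom_mkAlgHom_apply LaurentRing (FreeAlgebra.lift LaurentRing (leftOp cs))
    _ _).trans (FreeAlgebra.lift_ι_apply _ _)

theorem regularRep_stdElt (w : W) :
    regularRep cs (stdElt cs w) (Finsupp.single 1 1) = Finsupp.single w 1 := by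
  obtain ⟨h1, h2⟩ := (cs.exists_isReduced w).choose_spec
  conv_rhs => rw [h2]
  rw [stdElt, map_list_prod, List.map_map]
  have : (regularRep cs : HeckeAlgebra M → _) ∘ gen M = leftOp cs :=
    funext (regularRep_gen cs)
  rw [this, prod_leftOp_single_one cs h1]

theorem linearIndependent_stdElt : LinearIndependent LaurentRing (stdElt cs) := by
  let ev : HeckeAlgebra M →ₗ[LaurentRing] (W →₀ LaurentRing) :=
    (LinearMap.applyₗ (Finsupp.single 1 1)).comp (regularRep cs).toLinearMap
  have h : ev ∘ stdElt cs = fun w => Finsupp.single w 1 := funext (regularRep_stdElt cs)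
  refine LinearIndependent.of_comp ev ?_
  rw [h]
  exact Finsupp.linearIndependent_single_one LaurentRing W

variable (hM : ∀ i j, i ≠ j → M i j ≠ 0)
include hM

theorem stdElt_wordProd {ω : List B} (hω : cs.IsReduced ω) :
    stdElt cs (cs.wordProd ω) = (ω.map (gen M)).prod := by
  obtain ⟨h1, h2⟩ := (cs.exists_isReduced (cs.wordProd ω)).choose_spec
  exact cs.prod_map_eq_of_isReduced hM (gen M) gen_braid h1 hω h2.symm

theorem stdElt_one : stdElt cs (1 : W) = 1 := by
  have h : cs.IsReduced [] := by simp [CoxeterSystem.IsReduced]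
  simpa using stdElt_wordProd cs hM h

theorem stdElt_mul {x y : W} (h : cs.length (x * y) = cs.length x + cs.length y) :
    stdElt cs x * stdElt cs y = stdElt cs (x * y) := by
  obtain ⟨ω, hω, rfl⟩ := cs.exists_isReduced x
  obtain ⟨τ, hτ, rfl⟩ := cs.exists_isReduced y
  have hr : cs.IsReduced (ω ++ τ) := by
    rw [CoxeterSystem.IsReduced, cs.wordProd_append, h, hω.eq, hτ.eq, List.length_append]
  rw [← cs.wordProd_append, stdElt_wordProd cs hM hω, stdElt_wordProd cs hM hτ,
    stdElt_wordProd cs hM hr, List.map_append, List.prod_append]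

theorem stdElt_simple (i : B) : stdElt cs (cs.simple i) = gen M i := by
  have h : cs.IsReduced [i] := by simp [CoxeterSystem.IsReduced]
  simpa using stdElt_wordProd cs hM h

theorem gen_mul_stdElt (i : B) (w : W) :
    gen M i * stdElt cs w = stdElt cs (cs.simple i * w) + leftCoeff cs i w • stdElt cs w := by
  have up (w : W) (h : ¬ cs.IsLeftDescent w i) :
      gen M i * stdElt cs w = stdElt cs (cs.simple i * w) := by
    rw [← stdElt_simple cs hM, stdElt_mul cs hM]
    rw [cs.not_isLeftDescent_iff.mp h, cs.length_simple, add_comm]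
  by_cases h : cs.IsLeftDescent w i
  · have h' := up _ (cs.isLeftDescent_iff_not_isLeftDescent_mul.mp h)
    rw [cs.simple_mul_simple_cancel_left] at h'
    rw [leftCoeff_of_isLeftDescent cs h, ← h', ← mul_assoc, gen_mul_self, add_mul, one_mul,
      smul_mul_assoc]
  · rw [up w h, leftCoeff_eq_zero cs h, zero_smul, add_zero]

theorem stdElt_mul_gen (i : B) (w : W) :
    stdElt cs w * gen M i = stdElt cs (w * cs.simple i) + rightCoeff cs i w • stdElt cs w := by
  have up (w : W) (h : ¬ cs.IsRightDescent w i) :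
      stdElt cs w * gen M i = stdElt cs (w * cs.simple i) := by
    rw [← stdElt_simple cs hM, stdElt_mul cs hM]
    rw [cs.not_isRightDescent_iff.mp h, cs.length_simple]
  by_cases h : cs.IsRightDescent w i
  · have h' := up _ (cs.isRightDescent_iff_not_isRightDescent_mul.mp h)
    rw [cs.simple_mul_simple_cancel_right] at h'
    rw [rightCoeff_of_isRightDescent cs h, ← h', mul_assoc, gen_mul_self, mul_add, mul_one,
      mul_smul_comm]
  · rw [up w h, rightCoeff_eq_zero cs h, zero_smul, add_zero]

theorem span_stdElt : Submodule.span LaurentRing (Set.range (stdElt cs)) = ⊤ := by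
  set S := Submodule.span LaurentRing (Set.range (stdElt cs)) with hS
  have hgen (i : B) (h : HeckeAlgebra M) (hh : h ∈ S) : gen M i * h ∈ S := by
    induction hh using Submodule.span_induction with
    | mem x hx =>
      obtain ⟨w, rfl⟩ := hx
      rw [gen_mul_stdElt cs hM]
      exact S.add_mem (Submodule.subset_span ⟨_, rfl⟩)
        (S.smul_mem _ (Submodule.subset_span ⟨_, rfl⟩))
    | zero => simp
    | add x y _ _ hx hy => rw [mul_add]; exact S.add_mem hx hy
    | smul a x _ hx => rw [mul_smul_comm]; exact S.smul_mem _ hx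
  have hmul (a : FreeAlgebra LaurentRing B) : ∀ h ∈ S, ofFree M a * h ∈ S := by
    induction a with
    | grade0 r =>
      intro h hh
      rw [AlgHom.commutes, ← Algebra.smul_def]
      exact S.smul_mem _ hh
    | grade1 i => exact hgen i
    | mul a b ha hb =>
      intro h hh
      rw [map_mul, mul_assoc]
      exact ha _ (hb _ hh)
    | add a b ha hb =>
      intro h hh
      rw [map_add, add_mul]
      exact S.add_mem (ha _ hh) (hb _ hh)
  rw [eq_top_iff]
  intro h _
  obtain ⟨a, rfl⟩ := RingQuot.mkAlgHom_surjective LaurentRing (Rel M) h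
  have := hmul a 1 (by rw [← stdElt_one cs hM]; exact Submodule.subset_span ⟨_, rfl⟩)
  rwa [mul_one] at this

/-- The standard basis `(H_w)` of the Hecke algebra. -/
noncomputable def stdBasis : Module.Basis W LaurentRing (HeckeAlgebra M) :=
  Module.Basis.mk (linearIndependent_stdElt cs) (span_stdElt cs hM).ge

theorem stdBasis_apply (w : W) : stdBasis cs hM w = stdElt cs w := Module.Basis.mk_apply _ _ w

end KLHecke

/-! ### Laurent polynomials with terms of positive degree only -/

namespace KLHecke

open LaurentPolynomial in
theorem coeff_v_mul (c : LaurentRing) (n : ℤ) : (v * c).coeff n = c.coeff (n - 1) := by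
  rw [v, T, AddMonoidAlgebra.coeff_single_mul_apply, one_mul, neg_add_eq_sub]

open LaurentPolynomial in
theorem coeff_vInv_mul (c : LaurentRing) (n : ℤ) : (vInv * c).coeff n = c.coeff (n + 1) := by
  rw [vInv, T, AddMonoidAlgebra.coeff_single_mul_apply, one_mul, neg_neg, add_comm]

theorem v_mul_vInv : v * vInv = 1 := by
  rw [v, vInv, ← LaurentPolynomial.T_add, add_neg_cancel, LaurentPolynomial.T_zero]

theorem invert_v : LaurentPolynomial.invert (R := ℤ) v = vInv := LaurentPolynomial.invert_T 1

/-- The subgroup `v ℤ[v]` of `ℤ[v, v⁻¹]`. -/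
def posPart : AddSubgroup LaurentRing where
  carrier := {c | ∀ n ≤ 0, c.coeff n = 0}
  zero_mem' n _ := rfl
  add_mem' {a b} ha hb n hn := by
    rw [AddMonoidAlgebra.coeff_add, Finsupp.add_apply, ha n hn, hb n hn, add_zero]
  neg_mem' {a} ha n hn := by
    rw [AddMonoidAlgebra.coeff_neg, Finsupp.neg_apply, ha n hn, neg_zero]

theorem toLaurent_X_mul_mem_posPart (q : Polynomial ℤ) :
    Polynomial.toLaurent (Polynomial.X * q) ∈ posPart := by
  intro n hn
  rw [LaurentPolynomial.coeff_toLaurent]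
  rcases eq_or_lt_of_le hn with rfl | hlt
  · have := Finsupp.mapDomain_apply (Nat.castEmbedding (R := ℤ)).injective
      (Polynomial.X * q).toFinsupp.coeff 0
    refine Eq.trans this ?_
    exact Polynomial.coeff_X_mul_zero q
  · refine Finsupp.mapDomain_of_notMem_range _ _ ?_
    rintro ⟨k, hk⟩
    simp at hk
    omega

theorem toLaurent_X_mul_divX_trunc {c : LaurentRing} (hc : c ∈ posPart) :
    Polynomial.toLaurent (Polynomial.X * (LaurentPolynomial.trunc c).divX) = c := by
  have h0 : (LaurentPolynomial.trunc c).coeff 0 = 0 := hc 0 le_rfl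
  have h1 : Polynomial.X * (LaurentPolynomial.trunc c).divX = LaurentPolynomial.trunc c := by
    have := (LaurentPolynomial.trunc c).X_mul_divX_add
    rwa [h0, map_zero, add_zero] at this
  rw [h1]
  refine LaurentPolynomial.ext fun n => ?_
  rw [LaurentPolynomial.coeff_toLaurent]
  rcases lt_or_ge n 0 with hn | hn
  · rw [hc n hn.le]
    refine Finsupp.mapDomain_of_notMem_range _ _ ?_
    rintro ⟨k, hk⟩
    simp at hk
    omega
  · lift n to ℕ using hn
    exact Finsupp.mapDomain_apply (Nat.castEmbedding (R := ℤ)).injective _ n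

theorem eq_zero_of_invert_eq {c : LaurentRing} (hc : c ∈ posPart)
    (h : LaurentPolynomial.invert (R := ℤ) c = c) : c = 0 := by
  refine LaurentPolynomial.ext fun n => ?_
  rcases le_or_gt n 0 with hn | hn
  · exact hc n hn
  · rw [← h, LaurentPolynomial.invert_apply]
    exact hc _ (by omega)

theorem v_mul_mem_posPart {c : LaurentRing} (hc : c ∈ posPart) : v * c ∈ posPart := fun n hn => by
  rw [coeff_v_mul, hc _ (by omega)]

theorem v_mem_posPart : v ∈ posPart := fun n hn => by
  rw [v, LaurentPolynomial.T_apply, if_neg (by omega)]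

/-! ### The length filtration and unitriangular families -/

variable {B W : Type*} [Group W] {M : CoxeterMatrix B} (cs : CoxeterSystem M W)

/-- The span of the standard basis elements `H_u` with `ℓ(u) < n`. -/
noncomputable def lengthFilt (n : ℕ) : Submodule LaurentRing (HeckeAlgebra M) :=
  Submodule.span LaurentRing (stdElt cs '' {u | cs.length u < n})

theorem lengthFilt_mono : Monotone (lengthFilt cs) := fun _ _ h =>
  Submodule.span_mono (Set.image_mono fun _ hu => lt_of_lt_of_le hu h)

theorem stdElt_mem_lengthFilt {u : W} {n : ℕ} (h : cs.length u < n) :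
    stdElt cs u ∈ lengthFilt cs n := Submodule.subset_span ⟨u, h, rfl⟩

/-- A linear map that sends each standard basis element in `lengthFilt cs n` into `S` sends
`lengthFilt cs n` into `S`. -/
theorem map_mem_of_mem_lengthFilt {n : ℕ} (φ : HeckeAlgebra M →ₗ[LaurentRing] HeckeAlgebra M)
    (S : Submodule LaurentRing (HeckeAlgebra M))
    (hφ : ∀ u, cs.length u < n → φ (stdElt cs u) ∈ S) {h : HeckeAlgebra M}
    (hh : h ∈ lengthFilt cs n) : φ h ∈ S := by
  refine (Submodule.span_le.mpr ?_ : lengthFilt cs n ≤ S.comap φ) hh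
  rintro _ ⟨u, hu, rfl⟩
  exact hφ u hu

variable (hM : ∀ i j, i ≠ j → M i j ≠ 0)
include hM

theorem mem_lengthFilt_iff {n : ℕ} {h : HeckeAlgebra M} :
    h ∈ lengthFilt cs n ↔ ∀ u, n ≤ cs.length u → (stdBasis cs hM).repr h u = 0 := by
  have e : stdElt cs = stdBasis cs hM := funext fun w => (stdBasis_apply cs hM w).symm
  rw [lengthFilt, e, Module.Basis.mem_span_image]
  refine ⟨fun hs u hu => ?_, fun hs u hu => ?_⟩
  · by_contra hne
    exact absurd (hs (Finsupp.mem_support_iff.mpr hne)) (not_lt.mpr hu)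
  · by_contra hne
    exact (Finsupp.mem_support_iff.mp hu) (hs u (not_lt.mp hne))

theorem repr_stdElt (u : W) : (stdBasis cs hM).repr (stdElt cs u) = Finsupp.single u 1 := by
  rw [← stdBasis_apply cs hM, Module.Basis.repr_self]

theorem gen_mul_mem_lengthFilt (i : B) {n : ℕ} {h : HeckeAlgebra M} (hh : h ∈ lengthFilt cs n) :
    gen M i * h ∈ lengthFilt cs (n + 1) := by
  refine map_mem_of_mem_lengthFilt cs (LinearMap.mulLeft LaurentRing (gen M i)) _
    (fun u hu => ?_) hh
  rw [LinearMap.mulLeft_apply, gen_mul_stdElt cs hM]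
  refine add_mem (stdElt_mem_lengthFilt cs ?_) (Submodule.smul_mem _ _
    (stdElt_mem_lengthFilt cs (by omega)))
  rcases cs.length_simple_mul u i with h | h <;> omega

theorem mul_gen_mem_lengthFilt (i : B) {n : ℕ} {h : HeckeAlgebra M} (hh : h ∈ lengthFilt cs n) :
    h * gen M i ∈ lengthFilt cs (n + 1) := by
  refine map_mem_of_mem_lengthFilt cs (LinearMap.mulRight LaurentRing (gen M i)) _
    (fun u hu => ?_) hh
  rw [LinearMap.mulRight_apply, stdElt_mul_gen cs hM]
  refine add_mem (stdElt_mem_lengthFilt cs ?_) (Submodule.smul_mem _ _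
    (stdElt_mem_lengthFilt cs (by omega)))
  rcases cs.length_mul_simple u i with h | h <;> omega

theorem stdElt_mul_mem_lengthFilt (z : W) {n : ℕ} {h : HeckeAlgebra M}
    (hh : h ∈ lengthFilt cs n) : stdElt cs z * h ∈ lengthFilt cs (cs.length z + n) := by
  obtain ⟨ω, hω, rfl⟩ := cs.exists_isReduced z
  rw [stdElt_wordProd cs hM hω, hω.eq]
  clear hω
  induction ω with
  | nil => simpa using hh
  | cons i ω ih =>
    rw [List.map_cons, List.prod_cons, mul_assoc, List.length_cons, add_right_comm]
    exact gen_mul_mem_lengthFilt cs hM i ih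

theorem bar_stdElt_sub_mem (w : W) :
    bar M (stdElt cs w) - stdElt cs w ∈ lengthFilt cs (cs.length w) := by
  induction hn : cs.length w generalizing w with
  | zero =>
    rw [cs.length_eq_zero_iff.mp hn, stdElt_one cs hM, map_one, sub_self]
    exact zero_mem _
  | succ n ih =>
    have hw : w ≠ 1 := by rintro rfl; simp at hn
    obtain ⟨i, hi⟩ := cs.exists_leftDescent_of_ne_one hw
    have hl := cs.isLeftDescent_iff.mp hi
    have hln : cs.length (cs.simple i * w) = n := by omega
    have e : stdElt cs w = gen M i * stdElt cs (cs.simple i * w) := by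
      rw [gen_mul_stdElt cs hM, leftCoeff_eq_zero cs
        (cs.isLeftDescent_iff_not_isLeftDescent_mul.mp hi), cs.simple_mul_simple_cancel_left,
        zero_smul, add_zero]
    have hy := ih _ hln
    set y := stdElt cs (cs.simple i * w)
    have hyn : y ∈ lengthFilt cs (n + 1) := stdElt_mem_lengthFilt cs (by omega)
    have hby : bar M y ∈ lengthFilt cs (n + 1) := by
      have := add_mem (lengthFilt_mono cs (Nat.le_succ n) hy) hyn
      rwa [sub_add_cancel] at this
    have hbar : bar M (gen M i) = gen M i + (v - vInv) • 1 := bar_gen M i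
    have e2 : bar M (gen M i * y) - gen M i * y =
        gen M i * (bar M y - y) + (v - vInv) • bar M y := by
      rw [map_mul, hbar, add_mul, smul_mul_assoc, one_mul, mul_sub]
      abel
    rw [e, e2]
    exact add_mem (gen_mul_mem_lengthFilt cs hM i hy) (Submodule.smul_mem _ _ hby)

/-- The leading coefficients of a combination of a family that is unitriangular with respect to
the standard basis. -/
theorem repr_linearCombination_of_max {g : W → HeckeAlgebra M}
    (hg : ∀ w, g w - stdElt cs w ∈ lengthFilt cs (cs.length w)) (c : W →₀ LaurentRing) {x : W}
    (hx : ∀ y, c y ≠ 0 → cs.length y ≤ cs.length x) :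
    (stdBasis cs hM).repr (Finsupp.linearCombination LaurentRing g c) x = c x := by
  have h1 : Finsupp.linearCombination LaurentRing g c -
      Finsupp.linearCombination LaurentRing (stdBasis cs hM) c ∈
        lengthFilt cs (cs.length x) := by
    rw [Finsupp.linearCombination_apply, Finsupp.linearCombination_apply, Finsupp.sum,
      Finsupp.sum, ← Finset.sum_sub_distrib]
    refine sum_mem fun y hy => ?_
    rw [← smul_sub, stdBasis_apply]
    exact Submodule.smul_mem _ _
      (lengthFilt_mono cs (hx y (Finsupp.mem_support_iff.mp hy)) (hg y))
  have h2 := (mem_lengthFilt_iff cs hM).mp h1 x le_rfl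
  rwa [map_sub, Module.Basis.repr_linearCombination, Finsupp.sub_apply, sub_eq_zero] at h2

omit hM in
theorem exists_max_length_of_ne_zero {c : W →₀ LaurentRing} (hc : c ≠ 0) :
    ∃ x, c x ≠ 0 ∧ ∀ y, c y ≠ 0 → cs.length y ≤ cs.length x := by
  obtain ⟨x, hx, hmax⟩ := c.support.exists_max_image cs.length
    (Finsupp.support_nonempty_iff.mpr hc)
  exact ⟨x, Finsupp.mem_support_iff.mp hx, fun y hy => hmax y (Finsupp.mem_support_iff.mpr hy)⟩

theorem linearIndependent_of_unitriangular {g : W → HeckeAlgebra M}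
    (hg : ∀ w, g w - stdElt cs w ∈ lengthFilt cs (cs.length w)) :
    LinearIndependent LaurentRing g := by
  rw [linearIndependent_iff]
  intro c hc
  by_contra hne
  obtain ⟨x, hx, hmax⟩ := exists_max_length_of_ne_zero cs hne
  have := repr_linearCombination_of_max cs hM hg c hmax
  rw [hc, map_zero, Finsupp.zero_apply] at this
  exact hx this.symm

/-- Let `N` be a submodule all of whose elements have their leading terms in `X`, and let `N`
contain for each `x ∈ X` an element `g x` with leading term `H_x`. Then these elements span `N`:
the leading terms of any `h ∈ N` can be removed by subtracting multiples of them. -/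
theorem le_span_of_leading {N : Submodule LaurentRing (HeckeAlgebra M)} {X : Set W}
    {g : W → HeckeAlgebra M} (hgN : ∀ x ∈ X, g x ∈ N)
    (hg : ∀ x ∈ X, g x - stdElt cs x ∈ lengthFilt cs (cs.length x))
    (hN : ∀ h ∈ N, ∀ x, (stdBasis cs hM).repr h x ≠ 0 →
      (∀ y, (stdBasis cs hM).repr h y ≠ 0 → cs.length y ≤ cs.length x) → x ∈ X) :
    N ≤ Submodule.span LaurentRing (g '' X) := by
  have key (n : ℕ) : ∀ h ∈ N, h ∈ lengthFilt cs n → h ∈ Submodule.span LaurentRing (g '' X) := by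
    induction n with
    | zero =>
      intro h _ hh
      simp only [lengthFilt, Nat.not_lt_zero, Set.ofPred_false, Set.image_empty,
        Submodule.span_empty, Submodule.mem_bot] at hh
      rw [hh]
      exact zero_mem _
    | succ n ih =>
      intro h hhN hh
      classical
      set b := stdBasis cs hM with hb
      set S := (b.repr h).support.filter fun x => cs.length x = n with hS
      have hlt (y : W) (hy : b.repr h y ≠ 0) : cs.length y < n + 1 := by
        by_contra hcon
        exact hy ((mem_lengthFilt_iff cs hM).mp hh y (not_lt.mp hcon))
      have hSX (x : W) (hx : x ∈ S) : x ∈ X := by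
        obtain ⟨hx1, hx2⟩ := Finset.mem_filter.mp hx
        refine hN h hhN x (Finsupp.mem_support_iff.mp hx1) fun y hy => ?_
        have := hlt y hy
        omega
      have hsum : ∑ x ∈ S, b.repr h x • g x ∈ Submodule.span LaurentRing (g '' X) :=
        sum_mem fun x hx => Submodule.smul_mem _ _ (Submodule.subset_span ⟨x, hSX x hx, rfl⟩)
      have hsumN : ∑ x ∈ S, b.repr h x • g x ∈ N :=
        sum_mem fun x hx => Submodule.smul_mem _ _ (hgN x (hSX x hx))
      have e : h - ∑ x ∈ S, b.repr h x • g x =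
          ∑ x ∈ (b.repr h).support.filter (fun x => ¬ cs.length x = n), b.repr h x • b x -
            ∑ x ∈ S, b.repr h x • (g x - b x) := by
        have e1 : ∑ x ∈ (b.repr h).support, b.repr h x • b x = h := b.linearCombination_repr h
        rw [← Finset.sum_filter_add_sum_filter_not _ (fun x => cs.length x = n)] at e1
        simp only [smul_sub, Finset.sum_sub_distrib]
        rw [← sub_add, sub_add_eq_add_sub, add_comm _ (∑ x ∈ S, _), e1]
      have hrest : h - ∑ x ∈ S, b.repr h x • g x ∈ Submodule.span LaurentRing (g '' X) := by
        refine ih _ (sub_mem hhN hsumN) ?_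
        rw [e]
        refine sub_mem (sum_mem fun x hx => Submodule.smul_mem _ _ ?_)
          (sum_mem fun x hx => Submodule.smul_mem _ _ ?_)
        · obtain ⟨hx1, hx2⟩ := Finset.mem_filter.mp hx
          have := hlt x (Finsupp.mem_support_iff.mp hx1)
          rw [hb, stdBasis_apply]
          exact stdElt_mem_lengthFilt cs (by omega)
        · have := hg x (hSX x hx)
          rw [(Finset.mem_filter.mp hx).2] at this
          rwa [hb, stdBasis_apply]
      simpa using add_mem hrest hsum
  intro h hh
  obtain ⟨n, hn⟩ : ∃ n, ∀ u ∈ ((stdBasis cs hM).repr h).support, cs.length u < n :=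
    ⟨((stdBasis cs hM).repr h).support.sup cs.length + 1, fun u hu =>
      Nat.lt_succ_of_le (Finset.le_sup hu)⟩
  refine key n h hh ((mem_lengthFilt_iff cs hM).mpr fun u hu => ?_)
  by_contra hne
  exact absurd (hn u (Finsupp.mem_support_iff.mpr hne)) (not_lt.mpr hu)

end KLHecke

/-! ### Existence and uniqueness of the Kazhdan-Lusztig basis -/

namespace KLHecke

variable {B W : Type*} [Group W] {M : CoxeterMatrix B} (cs : CoxeterSystem M W)

/-- The submodule of all `h` with `h H_s = v⁻¹ h`, for all `s` in a set `J` of simple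
reflections. -/
def rightEigen (J : Set B) : Submodule LaurentRing (HeckeAlgebra M) where
  carrier := {h | ∀ i ∈ J, h * gen M i = vInv • h}
  zero_mem' i _ := by rw [zero_mul, smul_zero]
  add_mem' {a b} ha hb i hi := by rw [add_mul, ha i hi, hb i hi, smul_add]
  smul_mem' c a ha i hi := by rw [smul_mul_assoc, ha i hi, smul_comm]

variable (hM : ∀ i j, i ≠ j → M i j ≠ 0)
include hM

/-- The `v ℤ[v]`-lattice with basis `(H_w)`. -/
noncomputable def posLattice : AddSubgroup (HeckeAlgebra M) where
  carrier := {h | ∀ u, (stdBasis cs hM).repr h u ∈ posPart}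
  zero_mem' u := by rw [map_zero]; exact zero_mem _
  add_mem' {a b} ha hb u := by rw [map_add]; exact add_mem (ha u) (hb u)
  neg_mem' {a} ha u := by rw [map_neg]; exact neg_mem (ha u)

/-- A Kazhdan-Lusztig element of `w` which differs from `H_w` by a combination of elements `H_u`
with `ℓ(u) < ℓ(w)`. -/
structure IsTriangularKL (w : W) (b : HeckeAlgebra M) : Prop where
  bar_eq : bar M b = b
  sub_mem_posLattice : b - stdElt cs w ∈ posLattice cs hM
  sub_mem_lengthFilt : b - stdElt cs w ∈ lengthFilt cs (cs.length w)

theorem isKLElt_iff {w : W} {h : HeckeAlgebra M} :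
    IsKLElt cs w h ↔ bar M h = h ∧ h - stdElt cs w ∈ posLattice cs hM := by
  classical
  refine and_congr_right fun _ => ⟨?_, fun hh => ?_⟩
  · rintro ⟨p, rfl⟩
    rw [add_sub_cancel_left]
    refine sum_mem fun u _ x => ?_
    rw [map_smul, repr_stdElt cs hM, Finsupp.smul_apply, Finsupp.single_apply]
    split_ifs
    · rw [smul_eq_mul, mul_one]
      exact toLaurent_X_mul_mem_posPart _
    · rw [smul_zero]
      exact zero_mem _
  · set b := stdBasis cs hM with hb
    let φ : LaurentRing → Polynomial ℤ := fun c => (LaurentPolynomial.trunc c).divX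
    refine ⟨(b.repr (h - stdElt cs w)).mapRange φ (by simp [φ]), ?_⟩
    rw [Finsupp.sum_mapRange_index (by simp)]
    have e : ((b.repr (h - stdElt cs w)).sum fun u c =>
        Polynomial.toLaurent (Polynomial.X * φ c) • stdElt cs u) = h - stdElt cs w := by
      conv_rhs => rw [← b.linearCombination_repr (h - stdElt cs w)]
      rw [Finsupp.linearCombination_apply]
      refine Finsupp.sum_congr fun u _ => ?_
      rw [toLaurent_X_mul_divX_trunc (hh u), hb, stdBasis_apply]
    rw [e, add_sub_cancel]

/-- The uniqueness of Kazhdan-Lusztig elements, in terms of differences. -/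
theorem eq_zero_of_bar_eq {h : HeckeAlgebra M} (hbar : bar M h = h)
    (hpos : h ∈ posLattice cs hM) : h = 0 := by
  set b := stdBasis cs hM with hb
  by_contra hne
  have hne' : b.repr h ≠ 0 := by simpa using hne
  obtain ⟨x, hx, hmax⟩ := exists_max_length_of_ne_zero cs hne'
  -- The leading coefficient of `h` is invariant under `v ↦ v⁻¹`, and lies in `v ℤ[v]`.
  let c : W →₀ LaurentRing := (b.repr h).mapRange (LaurentPolynomial.invert (R := ℤ)) (map_zero _)
  have hc : Finsupp.linearCombination LaurentRing (fun w => bar M (stdElt cs w)) c = h := by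
    conv_rhs => rw [← hbar, ← b.linearCombination_repr h]
    rw [Finsupp.linearCombination_apply, Finsupp.linearCombination_apply,
      Finsupp.sum_mapRange_index (by simp), Finsupp.sum, Finsupp.sum, map_sum]
    refine Finset.sum_congr rfl fun u _ => ?_
    rw [bar_smul, hb, stdBasis_apply]
  have h1 := repr_linearCombination_of_max cs hM (bar_stdElt_sub_mem cs hM) c (x := x)
    (fun y hy => hmax y fun h0 => hy (by simp [c, h0]))
  rw [hc] at h1
  exact hx (eq_zero_of_invert_eq (hpos x) h1.symm)

theorem IsKLElt.unique {w : W} {h h' : HeckeAlgebra M} (H : IsKLElt cs w h)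
    (H' : IsKLElt cs w h') : h = h' := by
  rw [isKLElt_iff cs hM] at H H'
  rw [← sub_eq_zero]
  refine eq_zero_of_bar_eq cs hM (by rw [map_sub, H.1, H'.1]) ?_
  have := sub_mem H.2 H'.2
  rwa [sub_sub_sub_cancel_right] at this

theorem IsTriangularKL.isKLElt {w : W} {b : HeckeAlgebra M} (hb : IsTriangularKL cs hM w b) :
    IsKLElt cs w b := (isKLElt_iff cs hM).mpr ⟨hb.bar_eq, hb.sub_mem_posLattice⟩

theorem repr_mul_gen (h : HeckeAlgebra M) (i : B) (u : W) :
    (stdBasis cs hM).repr (h * gen M i) u =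
      (stdBasis cs hM).repr h (u * cs.simple i) +
        rightCoeff cs i u * (stdBasis cs hM).repr h u := by
  classical
  let φ : HeckeAlgebra M →ₗ[LaurentRing] LaurentRing :=
    (Finsupp.lapply u).comp
      ((stdBasis cs hM).repr.toLinearMap.comp (LinearMap.mulRight LaurentRing (gen M i)))
  let ψ : HeckeAlgebra M →ₗ[LaurentRing] LaurentRing :=
    (Finsupp.lapply (u * cs.simple i) + rightCoeff cs i u • Finsupp.lapply u).comp
      (stdBasis cs hM).repr.toLinearMap
  have e : φ = ψ := by
    refine (stdBasis cs hM).ext fun w => ?_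
    change (stdBasis cs hM).repr (stdBasis cs hM w * gen M i) u =
      (stdBasis cs hM).repr (stdBasis cs hM w) (u * cs.simple i) +
        rightCoeff cs i u * (stdBasis cs hM).repr (stdBasis cs hM w) u
    rw [stdBasis_apply, stdElt_mul_gen cs hM, map_add, map_smul, repr_stdElt, repr_stdElt,
      Finsupp.add_apply, Finsupp.smul_apply, Finsupp.single_apply, Finsupp.single_apply,
      Finsupp.single_apply, smul_eq_mul]
    have h1 : w * cs.simple i = u ↔ w = u * cs.simple i := by
      rw [← eq_mul_inv_iff_mul_eq, cs.inv_simple]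
    by_cases hwu : w = u
    · rw [hwu]; simp [eq_comm]
    · simp [h1, hwu]
  exact DFunLike.congr_fun e h

omit hM in
theorem mul_gen_add_v_eigen (h : HeckeAlgebra M) (i : B) :
    h * (gen M i + v • 1) * gen M i = vInv • (h * (gen M i + v • 1)) := by
  have : (gen M i + v • 1 : HeckeAlgebra M) * gen M i = vInv • (gen M i + v • 1) := by
    rw [add_mul, gen_mul_self, smul_mul_assoc, one_mul, smul_add, smul_smul, mul_comm vInv,
      v_mul_vInv]
    module
  rw [mul_assoc, this, mul_smul_comm]

omit hM in
theorem bar_gen_add_v (i : B) : bar M (gen M i + v • 1) = gen M i + v • 1 := by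
  have hbar : bar M (gen M i) = gen M i + (v - vInv) • 1 := bar_gen M i
  rw [map_add, hbar, bar_smul, map_one, invert_v]
  module

/-- One step of the construction of the Kazhdan-Lusztig basis: for `y s > y`, the element of `y s`
is `g y * (H_s + v)` minus integral multiples of shorter elements `g z`. Only elements with
`z s < z` are subtracted, so that the product with `H_s` is still `v⁻¹` times the element. -/
theorem exists_isTriangularKL_mul_simple {y : W} {i : B} (hy : ¬ cs.IsRightDescent y i)
    {g : W → HeckeAlgebra M}
    (hg : ∀ z, cs.length z ≤ cs.length y → IsTriangularKL cs hM z (g z) ∧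
      ∀ j, cs.IsRightDescent z j → g z * gen M j = vInv • g z) :
    ∃ b, IsTriangularKL cs hM (y * cs.simple i) b ∧ b * gen M i = vInv • b := by
  classical
  have hlen := cs.not_isRightDescent_iff.mp hy
  obtain ⟨hgy, -⟩ := hg y le_rfl
  set r := g y - stdElt cs y with hr
  set h := g y * (gen M i + v • 1) with hh
  set h' := v • stdElt cs y + r * (gen M i + v • 1) with hh'
  have e : h = stdElt cs (y * cs.simple i) + h' := by
    have hs : g y = stdElt cs y + r := by rw [hr, add_sub_cancel]
    rw [hh, hh', hs, add_mul, mul_add, stdElt_mul_gen cs hM, rightCoeff_eq_zero cs hy, zero_smul,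
      add_zero, mul_smul_comm, mul_one, add_assoc]
  have hrF : r ∈ lengthFilt cs (cs.length y) := hgy.sub_mem_lengthFilt
  have hrP : r ∈ posLattice cs hM := hgy.sub_mem_posLattice
  have hF : h' ∈ lengthFilt cs (cs.length y + 1) := by
    rw [hh', mul_add, mul_smul_comm, mul_one]
    exact add_mem (Submodule.smul_mem _ _ (stdElt_mem_lengthFilt cs (Nat.lt_succ_self _)))
      (add_mem (mul_gen_mem_lengthFilt cs hM i hrF)
        (Submodule.smul_mem _ _ (lengthFilt_mono cs (Nat.le_succ _) hrF)))
  have hcoeff (u : W) : (stdBasis cs hM).repr h' u = v * Finsupp.single y 1 u +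
      ((stdBasis cs hM).repr r (u * cs.simple i) +
        (rightCoeff cs i u + v) * (stdBasis cs hM).repr r u) := by
    rw [hh', mul_add, mul_smul_comm, mul_one, map_add, map_add, map_smul, map_smul,
      repr_stdElt, Finsupp.add_apply, Finsupp.add_apply, Finsupp.smul_apply, Finsupp.smul_apply,
      repr_mul_gen, smul_eq_mul, smul_eq_mul, add_mul, add_assoc]
  have hsingle (u : W) : v * Finsupp.single y (1 : LaurentRing) u ∈ posPart := by
    rw [Finsupp.single_apply]
    split_ifs
    · rw [mul_one]; exact v_mem_posPart
    · rw [mul_zero]; exact zero_mem _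
  have hasc (u : W) (hu : ¬ cs.IsRightDescent u i) :
      (stdBasis cs hM).repr h' u ∈ posPart := by
    rw [hcoeff, rightCoeff_eq_zero cs hu, zero_add]
    exact add_mem (hsingle u) (add_mem (hrP _) (v_mul_mem_posPart (hrP _)))
  have hneg (u : W) (n : ℤ) (hn : n < 0) : ((stdBasis cs hM).repr h' u).coeff n = 0 := by
    by_cases hu : cs.IsRightDescent u i
    · rw [hcoeff, rightCoeff_of_isRightDescent cs hu, sub_add_cancel,
        AddMonoidAlgebra.coeff_add, AddMonoidAlgebra.coeff_add, Finsupp.add_apply,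
        Finsupp.add_apply, coeff_vInv_mul, hsingle u n hn.le, hrP _ n hn.le,
        hrP _ (n + 1) (by omega)]
      rfl
    · exact hasc u hu n hn.le
  let m : W →₀ ℤ := ((stdBasis cs hM).repr h').mapRange (fun c => c.coeff 0) rfl
  have hm (u : W) (hu : u ∈ m.support) :
      cs.IsRightDescent u i ∧ cs.length u ≤ cs.length y := by
    have hu' : ((stdBasis cs hM).repr h' u).coeff 0 ≠ 0 :=
      (Finsupp.mem_support_iff (f := m)).mp hu
    constructor
    · by_contra hcon
      exact hu' (hasc u hcon 0 le_rfl)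
    · by_contra hcon
      rw [(mem_lengthFilt_iff cs hM).mp hF u (by omega)] at hu'
      exact hu' rfl
  have hgsub (u : W) (hu : u ∈ m.support) : IsTriangularKL cs hM u (g u) :=
    (hg u (hm u hu).2).1
  refine ⟨h - ∑ u ∈ m.support, m u • g u, ⟨?_, ?_, ?_⟩, ?_⟩
  · rw [map_sub, map_sum, hh, map_mul, bar_gen_add_v, hgy.bar_eq]
    congr 1
    refine Finset.sum_congr rfl fun u hu => ?_
    rw [map_zsmul, (hgsub u hu).bar_eq]
  · have e2 : h - ∑ u ∈ m.support, m u • g u - stdElt cs (y * cs.simple i) =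
        (h' - ∑ u ∈ m.support, m u • stdElt cs u) -
          ∑ u ∈ m.support, m u • (g u - stdElt cs u) := by
      simp only [smul_sub, Finset.sum_sub_distrib]
      rw [e]
      abel
    rw [e2]
    refine sub_mem (fun x n hn => ?_)
      (sum_mem fun u hu => zsmul_mem (hgsub u hu).sub_mem_posLattice _)
    have e3 : (stdBasis cs hM).repr (∑ u ∈ m.support, m u • stdElt cs u) x =
        LaurentPolynomial.C (m x) := by
      rw [map_sum, Finsupp.finsetSum_apply]
      simp only [map_zsmul, repr_stdElt, Finsupp.smul_apply, Finsupp.single_apply]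
      rw [Finset.sum_eq_single x]
      · rw [if_pos rfl]
        simp
      · intro u _ hu
        rw [if_neg hu, smul_zero]
      · intro hx
        rw [Finsupp.notMem_support_iff.mp hx, zero_smul]
    rw [map_sub, Finsupp.sub_apply, e3, AddMonoidAlgebra.coeff_sub, Finsupp.sub_apply,
      LaurentPolynomial.C_apply]
    rcases eq_or_lt_of_le hn with rfl | hlt
    · rw [if_pos rfl]
      exact sub_self _
    · rw [if_neg hlt.ne, hneg x n hlt, sub_zero]
  · rw [hlen, e, sub_right_comm, add_sub_cancel_left]
    refine sub_mem hF (sum_mem fun u hu => zsmul_mem ?_ _)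
    have hu' := (hm u hu).2
    have := add_mem (lengthFilt_mono cs (by omega) (hgsub u hu).sub_mem_lengthFilt)
      (stdElt_mem_lengthFilt cs (Nat.lt_succ_of_le hu'))
    rwa [sub_add_cancel] at this
  · rw [sub_mul, hh, mul_gen_add_v_eigen, smul_sub, Finset.sum_mul, Finset.smul_sum]
    congr 1
    refine Finset.sum_congr rfl fun u hu => ?_
    rw [smul_mul_assoc, (hg u (hm u hu).2).2 i (hm u hu).1, smul_comm]

theorem isTriangularKL_one : IsTriangularKL cs hM 1 1 := by
  have : (1 : HeckeAlgebra M) - stdElt cs 1 = 0 := by rw [stdElt_one cs hM, sub_self]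
  exact ⟨map_one _, this ▸ zero_mem _, this ▸ zero_mem _⟩

/-- The Kazhdan-Lusztig element of `w`, together with its eigenvalue property at the right descents
of `w`. Each right descent gives a construction of a Kazhdan-Lusztig element with this property at
that descent, and by uniqueness all these elements agree. -/
theorem isTriangularKL_klElt_and_mul_gen (w : W) :
    IsTriangularKL cs hM w (klElt cs w) ∧
      ∀ j, cs.IsRightDescent w j → klElt cs w * gen M j = vInv • klElt cs w := by
  induction hn : cs.length w using Nat.strong_induction_on generalizing w with
  | _ n ih =>
    have kl_eq {b : HeckeAlgebra M} (hb : IsTriangularKL cs hM w b) : klElt cs w = b :=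
      IsKLElt.unique cs hM (Classical.epsilon_spec ⟨b, hb.isKLElt⟩) hb.isKLElt
    have step (j : B) (hj : cs.IsRightDescent w j) : ∃ b, IsTriangularKL cs hM w b ∧
        b * gen M j = vInv • b := by
      have hj' := cs.isRightDescent_iff_not_isRightDescent_mul.mp hj
      have hl := cs.isRightDescent_iff.mp hj
      have := exists_isTriangularKL_mul_simple cs hM hj' (g := klElt cs)
        fun z hz => ih _ (by omega) z rfl
      rwa [cs.simple_mul_simple_cancel_right] at this
    refine ⟨?_, fun j hj => ?_⟩
    · rcases eq_or_ne w 1 with rfl | hw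
      · rw [kl_eq (isTriangularKL_one cs hM)]
        exact isTriangularKL_one cs hM
      · obtain ⟨j, hj⟩ := cs.exists_rightDescent_of_ne_one hw
        obtain ⟨b, hb, -⟩ := step j hj
        rw [kl_eq hb]
        exact hb
    · obtain ⟨b, hb, hbj⟩ := step j hj
      rw [kl_eq hb]
      exact hbj

theorem klElt_sub_mem (w : W) : klElt cs w - stdElt cs w ∈ lengthFilt cs (cs.length w) :=
  (isTriangularKL_klElt_and_mul_gen cs hM w).1.sub_mem_lengthFilt

theorem klElt_mul_gen {w : W} {j : B} (hj : cs.IsRightDescent w j) :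
    klElt cs w * gen M j = vInv • klElt cs w :=
  (isTriangularKL_klElt_and_mul_gen cs hM w).2 j hj

theorem span_klElt : Submodule.span LaurentRing (Set.range (klElt cs)) = ⊤ := by
  rw [eq_top_iff, ← Set.image_univ]
  exact le_span_of_leading cs hM (fun _ _ => trivial) (fun x _ => klElt_sub_mem cs hM x)
    fun _ _ _ _ _ => trivial

/-- The Kazhdan-Lusztig basis of the Hecke algebra. -/
noncomputable def klBasis : Module.Basis W LaurentRing (HeckeAlgebra M) :=
  Module.Basis.mk (linearIndependent_of_unitriangular cs hM (klElt_sub_mem cs hM))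
    (span_klElt cs hM).ge

theorem klBasis_apply (w : W) : klBasis cs hM w = klElt cs w := Module.Basis.mk_apply _ _ w

theorem appearsIn_iff {y : W} {h : HeckeAlgebra M} :
    AppearsIn cs y h ↔ (klBasis cs hM).repr h y ≠ 0 := by
  have e : klElt cs = klBasis cs hM := funext fun w => (klBasis_apply cs hM w).symm
  constructor
  · rintro ⟨c, hc, hy⟩
    rw [e] at hc
    have : h = Finsupp.linearCombination LaurentRing (klBasis cs hM) c := hc
    rwa [this, Module.Basis.repr_linearCombination]
  · intro hy
    refine ⟨(klBasis cs hM).repr h, ?_, hy⟩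
    rw [e]
    exact ((klBasis cs hM).linearCombination_repr h).symm

end KLHecke

/-! ### Parabolic subgroups -/

namespace KLHecke

variable {B W : Type*} [Group W] {M : CoxeterMatrix B} (cs : CoxeterSystem M W) {J : Set B}

theorem simple_mem_parabolic {i : B} (hi : i ∈ J) : cs.simple i ∈ parabolic cs J :=
  Subgroup.subset_closure ⟨i, hi, rfl⟩

theorem exists_isReduced_of_mem_parabolic {u : W} (hu : u ∈ parabolic cs J) :
    ∃ ω : List B, (∀ i ∈ ω, i ∈ J) ∧ cs.IsReduced ω ∧ u = cs.wordProd ω := by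
  have step (x : W) (i : B) (hi : i ∈ J)
      (ih : ∃ ω : List B, (∀ i ∈ ω, i ∈ J) ∧ cs.IsReduced ω ∧ x = cs.wordProd ω) :
      ∃ ω : List B, (∀ i ∈ ω, i ∈ J) ∧ cs.IsReduced ω ∧ x * cs.simple i = cs.wordProd ω := by
    obtain ⟨ω, hωJ, hω, rfl⟩ := ih
    by_cases hd : cs.IsRightDescent (cs.wordProd ω) i
    · obtain ⟨k, hk, e⟩ := cs.exists_eraseIdx_of_isRightDescent hd
      refine ⟨ω.eraseIdx k, fun j hj => hωJ j (List.mem_of_mem_eraseIdx hj), ?_, e⟩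
      have hl := cs.isRightDescent_iff.mp hd
      rw [hω.eq] at hl
      rw [CoxeterSystem.IsReduced, ← e, List.length_eraseIdx_of_lt hk]
      omega
    · have e : cs.wordProd ω * cs.simple i = cs.wordProd (ω ++ [i]) := by
        rw [cs.wordProd_append, cs.wordProd_singleton]
      refine ⟨ω ++ [i], fun j hj => ?_, ?_, e⟩
      · rcases List.mem_append.mp hj with h | h
        · exact hωJ j h
        · rwa [List.mem_singleton.mp h]
      · rw [CoxeterSystem.IsReduced, ← e, cs.not_isRightDescent_iff.mp hd, hω.eq]
        simp
  induction hu using Subgroup.closure_induction_right with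
  | one => exact ⟨[], by simp, by simp [CoxeterSystem.IsReduced], by simp⟩
  | mul_right x _ y hy ih =>
    obtain ⟨i, hi, rfl⟩ := hy
    exact step x i hi ih
  | mul_inv_cancel x _ y hy ih =>
    obtain ⟨i, hi, rfl⟩ := hy
    rw [cs.inv_simple]
    exact step x i hi ih

theorem exists_isRightDescent_of_mem_parabolic {u : W} (hu : u ∈ parabolic cs J) (hu1 : u ≠ 1) :
    ∃ i ∈ J, cs.IsRightDescent u i := by
  obtain ⟨ω, hωJ, hω, rfl⟩ := exists_isReduced_of_mem_parabolic cs hu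
  rcases List.eq_nil_or_concat ω with rfl | ⟨τ, i, rfl⟩
  · simp at hu1
  refine ⟨i, hωJ i (by simp), ?_⟩
  have h := cs.length_wordProd_le τ
  rw [CoxeterSystem.IsRightDescent, hω.eq, cs.wordProd_concat,
    cs.simple_mul_simple_cancel_right]
  simp
  omega

/-- Each coset `xW_J` contains an element of minimal length. Its length is not decreased by
reflections in `W_J`. -/
theorem exists_minimal_coset_representative (x : W) :
    ∃ c, c⁻¹ * x ∈ parabolic cs J ∧
      ∀ t ∈ parabolic cs J, cs.IsReflection t → cs.inversionParity c t ≠ 1 := by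
  obtain ⟨u, hu, hmin⟩ := WellFounded.has_min (measure fun u => cs.length (x * u)).wf
    (parabolic cs J : Set W) ⟨1, one_mem _⟩
  refine ⟨x * u, by simpa using hu, fun t ht htr h => ?_⟩
  rw [htr.inversionParity_eq_one_iff, mul_assoc] at h
  exact hmin (u * t) (mul_mem hu ht) h

/-- Let `w₀` be a longest element of `W_J`. An element `x` with right descent set containing `J`
factors as `x = z w₀` with `ℓ(x) = ℓ(z) + ℓ(w₀)`. -/
theorem length_eq_of_forall_isRightDescent {w₀ x : W}
    (hw₀ : IsLongestIn cs (parabolic cs J) w₀) (hx : ∀ i ∈ J, cs.IsRightDescent x i) :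
    cs.length x = cs.length (x * w₀⁻¹) + cs.length w₀ := by
  have zmod_eq_zero {a : ZMod 2} (h : a ≠ 1) : a = 0 := by revert a; decide
  obtain ⟨c, hcx, hc⟩ := exists_minimal_coset_representative cs (J := J) x
  have hconj {i : B} (hi : i ∈ J) {u : W} (hu : u ∈ parabolic cs J) :
      u * cs.simple i * u⁻¹ ∈ parabolic cs J :=
    mul_mem (mul_mem hu (simple_mem_parabolic cs hi)) (inv_mem hu)
  have hrefl (i : B) (u : W) : cs.IsReflection (u * cs.simple i * u⁻¹) := ⟨u, i, rfl⟩
  have hc0 {i : B} (hi : i ∈ J) {u : W} (hu : u ∈ parabolic cs J) :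
      cs.inversionParity c (u * cs.simple i * u⁻¹) = 0 :=
    zmod_eq_zero (hc _ (hconj hi hu) (hrefl i u))
  have hadd {u : W} (hu : u ∈ parabolic cs J) :
      cs.length (c * u) = cs.length c + cs.length u := by
    induction hn : cs.length u generalizing u with
    | zero => rw [cs.length_eq_zero_iff.mp hn, mul_one, add_zero]
    | succ n ih =>
      have hu1 : u ≠ 1 := by rintro rfl; simp at hn
      obtain ⟨i, hi, hd⟩ := exists_isRightDescent_of_mem_parabolic cs hu hu1
      have hu' := mul_mem hu (simple_mem_parabolic cs hi)
      have hl := cs.isRightDescent_iff.mp hd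
      have hd' : ¬ cs.IsRightDescent (c * (u * cs.simple i)) i := by
        rw [cs.isRightDescent_iff_not_isRightDescent_mul,
          cs.isRightDescent_iff_inversionParity] at hd
        rw [cs.isRightDescent_iff_inversionParity, cs.inversionParity_mul, hc0 hi hu', add_zero]
        exact hd
      have h2 := cs.not_isRightDescent_iff.mp hd'
      rw [mul_assoc, cs.simple_mul_simple_cancel_right, ih hu' (by omega)] at h2
      omega
  -- All reflections of `W_J` are inversions of `w₀`, so `g` has no right descent in `J`.
  set g := w₀⁻¹ * (c⁻¹ * x) with hg
  have hgP : g ∈ parabolic cs J := mul_mem (inv_mem hw₀.1) hcx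
  have hxe : x = c * (w₀ * g) := by simp [hg]
  have hg1 : g = 1 := by
    by_contra hne
    obtain ⟨i, hi, hd⟩ := exists_isRightDescent_of_mem_parabolic cs hgP hne
    have h1 : cs.inversionParity w₀ (g * cs.simple i * g⁻¹) = 1 := by
      rw [(hrefl i g).inversionParity_eq_one_iff]
      exact lt_of_le_of_ne (hw₀.2 _ (mul_mem hw₀.1 (hconj hi hgP)))
        ((hrefl i g).length_mul_left_ne w₀)
    have h2 := (cs.isRightDescent_iff_inversionParity _ _).mp (hx i hi)
    rw [hxe, cs.inversionParity_mul, hc0 hi (mul_mem hw₀.1 hgP), add_zero,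
      cs.inversionParity_mul, h1, (cs.isRightDescent_iff_inversionParity _ _).mp hd] at h2
    exact absurd h2 (by decide)
  rw [hg1, mul_one] at hxe
  rw [hxe, mul_inv_cancel_right, hadd hw₀.1]

theorem IsLongestIn.isRightDescent {w₀ : W} (hw₀ : IsLongestIn cs (parabolic cs J) w₀) {i : B}
    (hi : i ∈ J) : cs.IsRightDescent w₀ i :=
  lt_of_le_of_ne (hw₀.2 _ (mul_mem hw₀.1 (simple_mem_parabolic cs hi)))
    (cs.length_mul_simple_ne w₀ i)

/-! ### The left ideal generated by the element of the longest element of a parabolic subgroup -/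

variable (hM : ∀ i j, i ≠ j → M i j ≠ 0)
include hM

theorem forall_isRightDescent_of_leading {h : HeckeAlgebra M} (hh : h ∈ rightEigen J) {x : W}
    (hx : (stdBasis cs hM).repr h x ≠ 0)
    (hmax : ∀ y, (stdBasis cs hM).repr h y ≠ 0 → cs.length y ≤ cs.length x) :
    ∀ i ∈ J, cs.IsRightDescent x i := by
  intro i hi
  by_contra hd
  have h1 := repr_mul_gen cs hM h i x
  rw [hh i hi, map_smul, Finsupp.smul_apply, smul_eq_mul, rightCoeff_eq_zero cs hd, zero_mul,
    add_zero] at h1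
  have h2 := hmax (x * cs.simple i) fun h0 => hx <| by
    rw [← one_mul ((stdBasis cs hM).repr h x), ← v_mul_vInv, mul_assoc, h1, h0, mul_zero]
  have := cs.not_isRightDescent_iff.mp hd
  omega

theorem klElt_mem_rightEigen {x : W} (hx : ∀ i ∈ J, cs.IsRightDescent x i) :
    klElt cs x ∈ rightEigen J := fun i hi => klElt_mul_gen cs hM (hx i hi)

/-- The left ideal generated by the Kazhdan-Lusztig element of `w₀` consists of all
`h` with `h H_s = v⁻¹ h` for `s ∈ J`. An element `x` that is a leading term of such an `h` is `z w₀`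
with lengths adding up, so `H_z` times the generator has the same leading term. -/
theorem cyclicLeft_eq_rightEigen {w₀ : W} (hw₀ : IsLongestIn cs (parabolic cs J) w₀) :
    (cyclicLeft (klElt cs w₀)).restrictScalars LaurentRing = rightEigen J := by
  have hb : klElt cs w₀ ∈ rightEigen J :=
    klElt_mem_rightEigen cs hM fun i hi => hw₀.isRightDescent cs hi
  have hmul (a : HeckeAlgebra M) : a * klElt cs w₀ ∈ rightEigen J := fun i hi => by
    rw [mul_assoc, hb i hi, mul_smul_comm]
  apply le_antisymm
  · intro h hh
    obtain ⟨a, rfl⟩ := Submodule.mem_span_singleton.mp hh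
    exact hmul a
  · refine (le_span_of_leading cs hM (X := {x | ∀ i ∈ J, cs.IsRightDescent x i})
      (g := fun x => stdElt cs (x * w₀⁻¹) * klElt cs w₀) (fun x _ => hmul _) (fun x hx => ?_)
      fun h hh x hx hmax => forall_isRightDescent_of_leading cs hM hh hx hmax).trans
      (Submodule.span_le.mpr ?_)
    · have hl := length_eq_of_forall_isRightDescent cs hw₀ hx
      have e : stdElt cs x = stdElt cs (x * w₀⁻¹) * stdElt cs w₀ := by
        rw [stdElt_mul cs hM (by rw [inv_mul_cancel_right, hl]), inv_mul_cancel_right]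
      change stdElt cs (x * w₀⁻¹) * klElt cs w₀ - stdElt cs x ∈ _
      rw [e, ← mul_sub, hl]
      exact stdElt_mul_mem_lengthFilt cs hM _ (klElt_sub_mem cs hM w₀)
    · rintro _ ⟨x, -, rfl⟩
      exact Submodule.mem_span_singleton.mpr ⟨_, rfl⟩

theorem rightEigen_eq_span_klElt :
    (rightEigen J : Submodule LaurentRing (HeckeAlgebra M)) =
      Submodule.span LaurentRing (klElt cs '' {x | ∀ i ∈ J, cs.IsRightDescent x i}) := by
  apply le_antisymm
  · exact le_span_of_leading cs hM (fun x hx => klElt_mem_rightEigen cs hM hx)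
      (fun x _ => klElt_sub_mem cs hM x)
      fun h hh x hx hmax => forall_isRightDescent_of_leading cs hM hh hx hmax
  · rw [Submodule.span_le]
    rintro _ ⟨x, hx, rfl⟩
    exact klElt_mem_rightEigen cs hM hx

/-- A Kazhdan-Lusztig element that appears in an element of the left ideal generated by
the one of `w₀` lies in this ideal, as the ideal is spanned by Kazhdan-Lusztig elements and these
are linearly independent. -/
theorem klElt_mem_cyclicLeft_of_leftLE {w₀ u : W} (hw₀ : IsLongestIn cs (parabolic cs J) w₀)
    (hu : LeftLE cs w₀ u) : klElt cs u ∈ cyclicLeft (klElt cs w₀) := by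
  obtain ⟨w, hw⟩ := hu
  rw [appearsIn_iff cs hM] at hw
  have h1 : klElt cs w * klElt cs w₀ ∈
      (cyclicLeft (klElt cs w₀)).restrictScalars LaurentRing :=
    Submodule.mem_span_singleton.mpr ⟨klElt cs w, rfl⟩
  have e : klElt cs = klBasis cs hM := funext fun w => (klBasis_apply cs hM w).symm
  have hideal := cyclicLeft_eq_rightEigen cs hM hw₀
  rw [hideal, rightEigen_eq_span_klElt cs hM, e, Module.Basis.mem_span_image, ← e] at h1
  have h2 : klElt cs u ∈ (cyclicLeft (klElt cs w₀)).restrictScalars LaurentRing := by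
    rw [hideal]
    exact klElt_mem_rightEigen cs hM (h1 (Finsupp.mem_support_iff.mpr hw))
  exact h2

theorem cyclicLeft_le_leftModule (w : W) :
    (cyclicLeft (klElt cs w)).restrictScalars LaurentRing ≤ leftModule cs w := by
  intro h hh
  obtain ⟨a, rfl⟩ := Submodule.mem_span_singleton.mp hh
  have ha : a ∈ Submodule.span LaurentRing (Set.range (klElt cs)) := by
    rw [span_klElt cs hM]; trivial
  rw [smul_eq_mul]
  induction ha using Submodule.span_induction with
  | mem x hx =>
    obtain ⟨y, rfl⟩ := hx
    rw [← (klBasis cs hM).linearCombination_repr (klElt cs y * klElt cs w)]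
    refine sum_mem fun u hu => Submodule.smul_mem _ _ (Submodule.subset_span ⟨u, ?_, ?_⟩)
    · exact ⟨y, (appearsIn_iff cs hM).mpr (Finsupp.mem_support_iff.mp hu)⟩
    · exact (klBasis_apply cs hM u).symm
  | zero => rw [zero_mul]; exact zero_mem _
  | add x y _ _ hx hy =>
    rw [add_mul]
    exact add_mem (hx (Submodule.mem_span_singleton.mpr ⟨x, rfl⟩))
      (hy (Submodule.mem_span_singleton.mpr ⟨y, rfl⟩))
  | smul c x _ hx =>
    rw [smul_mul_assoc]
    exact Submodule.smul_mem _ _ (hx (Submodule.mem_span_singleton.mpr ⟨x, rfl⟩))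

end KLHecke

theorem theorem3 {B W : Type*} [Group W] {M : CoxeterMatrix B} (cs : CoxeterSystem M W)
    (hW : KLHecke.IsFiniteWeyl cs) (J : Set B) (w₀' : W)
    (hw₀' : KLHecke.IsLongestIn cs (KLHecke.parabolic cs J) w₀') :
    (KLHecke.cyclicLeft (KLHecke.klElt cs w₀')).restrictScalars KLHecke.LaurentRing =
        KLHecke.leftModule cs w₀' ∧
      ∀ u : W, KLHecke.LeftLE cs w₀' u →
        KLHecke.klElt cs u ∈ KLHecke.cyclicLeft (KLHecke.klElt cs w₀') := by
  have hM (i j : B) (hij : i ≠ j) : M i j ≠ 0 := by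
    rcases hW.2 i j hij with h | h | h | h <;> rw [h] <;> decide
  have hmem (u : W) (hu : KLHecke.LeftLE cs w₀' u) :
      KLHecke.klElt cs u ∈ KLHecke.cyclicLeft (KLHecke.klElt cs w₀') :=
    KLHecke.klElt_mem_cyclicLeft_of_leftLE cs hM hw₀' hu
  refine ⟨le_antisymm (KLHecke.cyclicLeft_le_leftModule cs hM w₀') ?_, hmem⟩
  refine Submodule.span_le.mpr ?_
  rintro _ ⟨u, hu, rfl⟩
  exact hmem u hu
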